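/- **Model.** Consider the infinite triangular grid with directions E, NE, NW, W, SW, SE. A system consists of $n$ particles on distinct nodes; each particle is contracted (it occupies a node) or expanded (it occupies a node and an edge from it toward a neighboring target node). All particles share the orientation, have no memory, and see the states of the nodes within two hops. A deterministic algorithm, the same for all particles, maps what a contracted particle sees either to "do nothing" or to "expand in direction $d$". An expanded particle is committed: it contracts to its target node once activated with that node empty (this is a *movement*). Activations are asynchronous: a particle first senses and decides, and later, after an arbitrary finite delay during which other particles may act, executes its decision. An expansion fails if its edge is already occupied, and a contraction fails if its target node is then occupied; conflicts are resolved by the adversary. Each particle is activated infinitely often (fairness). An *initial configuration* consists of contracted particles whose nodes induce a connected subgraph. An algorithm *solves Line formation* if, from every initial configuration and under every fair schedule, a configuration is reached in which all particles are contracted, connected and on one line of the grid. The *floor* of a configuration is the W–E line through its southernmost particles. **Algorithm WRain.** Write $e,f$ for the unit vectors E and NE. For a node $v$: $\mathrm{Upper}(v)$ holds if one of $v+\{-2e+2f,\,-e+2f,\,-2e+f,\,-e+f,\,f\}$ is occupied; $\mathrm{Lower}(v)$ holds if one of $v+\{-f,\,e-f,\,2e-f,\,e-2f,\,2e-2f\}$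 is occupied; $\mathrm{Pointed}(v)$ holds if a particle on a neighbor of $v$ is expanded toward $v$; $\mathrm{Near}(v)$ holds if some empty neighbor $u$ of $v$ has $\mathrm{Pointed}(u)$. A contracted particle at $v$ does nothing if $\mathrm{Near}(v)$; otherwise it expands toward E if $\mathrm{Pointed}(v)$; otherwise it expands toward SE if $\neg\mathrm{Upper}(v)\wedge\mathrm{Lower}(v)$; otherwise it does nothing. **Theorem.** Algorithm WRain is asymptotically optimal for Line formation in terms of the number of movements. Precisely: 1. From every initial configuration and under every fair schedule, WRain reaches a configuration in which all particles are contracted, connected and on the floor of the initial configuration, and which does not change any more. 2. There is a constant $K$ such that every such execution with $n$ particles has at most $Kn^2$ movements in total. 3. There are $c>0$ and $N$ such that for every $n\ge N$ there are initial configurations of $n$ particles with pairwise grid distances at most $2\sqrt n+2$, and, from every such configuration, every algorithm under every schedule makes at least $cn^2$ movements before any moment at which all particles are contracted, connected and on one line of the grid. 4. WRain solves Line formation, and there are constants $K',N'$ such that for all $n\ge N'$ and every algorithm $B$ that solves Line formation, the worst-case total number of movements of WRain over all initial configurations of $n$ particles and all fair schedules is at most $K'$ times that of $B$. -/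

import Mathlib

namespace Silbot

/-! The infinite triangular grid, in axial coordinates: the first axis points East, the second
one North-East. Rows West -- East are the sets of nodes with a given second coordinate. -/

abbrev Node : Type := ℤ × ℤ

/-- The six directions, on which all particles agree. -/
inductive Dir : Type
  | E | NE | NW | W | SW | SE

def Dir.vec : Dir → Node
  | .E => (1, 0)
  | .NE => (0, 1)
  | .NW => (-1, 1)
  | .W => (-1, 0)
  | .SW => (0, -1)
  | .SE => (1, -1)

def Dir.opp : Dir → Dir
  | .E => .W
  | .NE => .SW
  | .NW => .SE
  | .W => .E
  | .SW => .NE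
  | .SE => .NW

theorem Dir.vec_opp (d : Dir) : d.opp.vec = -d.vec := by
  cases d <;> rfl

theorem Dir.vec_ne_zero (d : Dir) : d.vec ≠ 0 := by
  cases d <;> simp [Dir.vec, Prod.ext_iff]

/-- The triangular grid graph. -/
def triGrid : SimpleGraph Node where
  Adj u v := ∃ d : Dir, v = u + d.vec
  symm := ⟨by
    rintro u v ⟨d, rfl⟩
    exact ⟨d.opp, by rw [Dir.vec_opp, add_neg_cancel_right]⟩⟩
  loopless := ⟨by
    rintro u ⟨d, h⟩
    exact d.vec_ne_zero (by simpa using h)⟩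

/-- The node `w` is within two hops of `v`: it is `v`, a neighbor of `v`, or a neighbor of a
neighbor of `v`. -/
def Visible (v w : Node) : Prop :=
  w = v ∨ triGrid.Adj v w ∨ ∃ u, triGrid.Adj v u ∧ triGrid.Adj u w

/-- What can be seen at a node: nothing, a contracted particle, or a particle that is expanded
along the edge leaving the node in direction `d`. -/
inductive NodeState : Type
  | empty
  | contracted
  | expanded (d : Dir)

/-- A picture of the grid. As the input of an algorithm, it is centred at the observing particle
(which is at the origin), and everything beyond two hops is blanked out. -/
abbrev View : Type := Node → NodeState

/-- A deterministic algorithm without memory, identical for all particles: from what a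
contracted particle sees, it either does nothing (`none`) or expands in some direction. Expanded
particles are not under the control of the algorithm. -/
abbrev Algorithm : Type := View → Option Dir

/-- The outcome of the sensing-and-computing part of an activation. -/
inductive Decision : Type
  | stay
  | expand (d : Dir)
  | contract

/-- The instantaneous state of a system of `n` particles: the node occupied by each particle, the
direction along which it is expanded (`none` for a contracted particle) and, for a particle that
has sensed and decided but has not yet executed its decision, that pending decision. -/
structure State (n : ℕ) : Type where
  pos : Fin n → Node
  dir : Fin n → Option Dir
  todo : Fin n → Option Decision

variable {n : ℕ}

open scoped Classical in
noncomputable def nodeState (C : State n) (v : Node) : NodeState :=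
  if h : ∃ p, C.pos p = v then
    match C.dir h.choose with
    | none => .contracted
    | some d => .expanded d
  else .empty

/-- No particle is at `v`. (It may still be semi-occupied.) -/
def EmptyNode (C : State n) (v : Node) : Prop := ∀ p, C.pos p ≠ v

open scoped Classical in
/-- What particle `p` sees. -/
noncomputable def view (C : State n) (p : Fin n) : View := fun o =>
  if Visible 0 o then nodeState C (C.pos p + o) else .empty

open scoped Classical in
/-- Sensing and computing. A contracted particle follows the algorithm; an expanded particle is
committed to contract to its target node, if it sees that node empty. -/
noncomputable def look (A : Algorithm) (C : State n) (p : Fin n) : Decision :=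
  match C.dir p with
  | none =>
    match A (view C p) with
    | none => .stay
    | some d => .expand d
  | some d => if EmptyNode C (C.pos p + d.vec) then .contract else .stay

/-- The edge leaving `v` in direction `d` is occupied by a particle at its other end. (A particle
at `v` itself that wants to expand is contracted, hence occupies no edge.) -/
def EdgeBlocked (C : State n) (v : Node) (d : Dir) : Prop :=
  ∃ q, C.pos q = v + d.vec ∧ C.dir q = some d.opp

open scoped Classical in
/-- Executing a decision, which may be outdated. An expansion succeeds unless the edge is already
occupied, a contraction to the target node succeeds if that node is empty at this moment. -/
noncomputable def act (C : State n) (p : Fin n) : Decision → State n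
  | .stay => { C with todo := Function.update C.todo p none }
  | .expand d =>
    { C with
      dir := if EdgeBlocked C (C.pos p) d then C.dir else Function.update C.dir p (some d)
      todo := Function.update C.todo p none }
  | .contract =>
    match C.dir p with
    | none => { C with todo := Function.update C.todo p none }
    | some d =>
      if EmptyNode C (C.pos p + d.vec) then
        { pos := Function.update C.pos p (C.pos p + d.vec)
          dir := Function.update C.dir p none
          todo := Function.update C.todo p none }
      else { C with todo := Function.update C.todo p none }

/-- One event at particle `p`: it senses and computes if it is between two activations, and it
executes its pending decision otherwise. -/
noncomputable def step (A : Algorithm) (C : State n) (p : Fin n) : State n :=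
  match C.todo p with
  | none => { C with todo := Function.update C.todo p (some (look A C p)) }
  | some a => act C p a

/-- The asynchronous execution of `A` from `C` under the schedule `σ`, which names the particle at
which the next event takes place. Arbitrary delays between the events of a particle are possible;
simultaneous events and the resolution of conflicts among them by the adversary amount to an order
of the events. -/
noncomputable def run (A : Algorithm) (C : State n) (σ : ℕ → Fin n) : ℕ → State n
  | 0 => C
  | t + 1 => step A (run A C σ t) (σ t)

/-- Every particle is scheduled infinitely often. -/
def Fair (σ : ℕ → Fin n) : Prop := ∀ p t, ∃ s, t ≤ s ∧ σ s = p

def AllContracted (C : State n) : Prop := ∀ p, C.dir p = none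

/-- The occupied nodes induce a connected subgraph of the grid. -/
def ConnectedConf (C : State n) : Prop := (triGrid.induce (Set.range C.pos)).Connected

/-- All particles lie on one line of the grid. -/
def Aligned (C : State n) : Prop :=
  ∃ (v : Node) (d : Dir), ∀ p, ∃ k : ℤ, C.pos p = v + k • d.vec

/-- Initial configurations: at most one particle per node, all particles contracted and connected,
and no particle in the middle of an activation. -/
def IsInitial (C : State n) : Prop :=
  Function.Injective C.pos ∧ AllContracted C ∧ ConnectedConf C ∧ ∀ p, C.todo p = none

/-- The target configurations of Line formation. -/
def IsLine (C : State n) : Prop := AllContracted C ∧ ConnectedConf C ∧ Aligned C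

/-- The row with second coordinate `y` is the floor of `C`: the line containing the southern side
of the smallest parallelogram with sides parallel to West--East and SouthWest--NorthEast that
encloses all particles. -/
def IsFloor (C : State n) (y : ℤ) : Prop := (∃ p, (C.pos p).2 = y) ∧ ∀ p, y ≤ (C.pos p).2

/-- All particles are contracted, connected, and on the row with second coordinate `y`. -/
def IsFinalOn (C : State n) (y : ℤ) : Prop :=
  AllContracted C ∧ ConnectedConf C ∧ ∀ p, (C.pos p).2 = y

/-- Any two particles are at distance at most `2 √n + 2` in the grid. -/
def Compact (C : State n) : Prop :=
  ∀ p q, (triGrid.dist (C.pos p) (C.pos q) : ℝ) ≤ 2 * Real.sqrt n + 2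

open scoped Classical in
/-- The number of movements (of a particle from a node to a neighboring one) among the first `t`
events. -/
noncomputable def moves (A : Algorithm) (C : State n) (σ : ℕ → Fin n) (t : ℕ) : ℕ :=
  ((Finset.range t).filter fun s => (run A C σ (s + 1)).pos ≠ (run A C σ s).pos).card

/-- The total number of movements of an execution. -/
noncomputable def totalMoves (A : Algorithm) (C : State n) (σ : ℕ → Fin n) : ℕ∞ :=
  ⨆ t, (moves A C σ t : ℕ∞)

/-- The largest total number of movements of an execution from an initial configuration of `n`
particles. -/
noncomputable def worstMoves (A : Algorithm) (n : ℕ) : ℕ∞ :=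
  ⨆ (C : State n) (_ : IsInitial C) (σ : ℕ → Fin n) (_ : Fair σ), totalMoves A C σ

/-- The algorithm solves Line formation, from every initial configuration and against every fair
asynchronous schedule. -/
def SolvesLineFormation (A : Algorithm) : Prop :=
  ∀ (n : ℕ) (C : State n) (σ : ℕ → Fin n), IsInitial C → Fair σ → ∃ t, IsLine (run A C σ t)

/-- The algorithm solves Line formation, and up to a constant factor no algorithm that does so
needs fewer movements in the worst case, when the number of particles is large. -/
def AsymptoticallyOptimal (A : Algorithm) : Prop :=
  SolvesLineFormation A ∧
    ∃ K N : ℕ, ∀ n, N ≤ n → ∀ B : Algorithm, SolvesLineFormation B →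
      worstMoves A n ≤ (K : ℕ∞) * worstMoves B n

/-! The algorithm WRain. The nodes around `v` are enumerated row by row, from North to South and
from West to East:
```
     1   2   3
   4   5   6   7
 8   9   v  10  11
  12  13  14  15
    16  17  18
```
-/

/-- Offsets of the positions 1, 2, 4, 5, 6. -/
def upperOffsets : List Node := [(-2, 2), (-1, 2), (-2, 1), (-1, 1), (0, 1)]

/-- Offsets of the positions 13, 14, 15, 17, 18. -/
def lowerOffsets : List Node := [(0, -1), (1, -1), (2, -1), (1, -2), (2, -2)]

def Upper (s : View) (v : Node) : Prop := ∃ o ∈ upperOffsets, s (v + o) ≠ .empty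

def Lower (s : View) (v : Node) : Prop := ∃ o ∈ lowerOffsets, s (v + o) ≠ .empty

/-- Some particle at a neighbor `v - d` of `v` is expanded toward `v`. -/
def Pointed (s : View) (v : Node) : Prop := ∃ d : Dir, s (v - d.vec) = .expanded d

/-- Some empty neighbor of `v` is pointed. -/
def Near (s : View) (v : Node) : Prop :=
  ∃ d : Dir, s (v + d.vec) = .empty ∧ Pointed s (v + d.vec)

open scoped Classical in
noncomputable def WRain : Algorithm := fun s =>
  if ¬ Near s 0 then
    if Pointed s 0 then some .E
    else if ¬ Upper s 0 ∧ Lower s 0 then some .SE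
    else none
  else none

end Silbot

/-! WRain only ever moves East or South-East, so every movement raises the first coordinate by one.
Both the quadratic bound and termination follow once the configuration is known never to drift or
spread by more than O(n).

That is what the invariant `Inv` provides. Particles alone need not stay connected while some of
them are in transit, so connectivity is stated for covered nodes, those occupied or pointed at
(`Cov`). The danger is a particle committed to leave an unpointed node toward South-East, possibly
on outdated information. The directed relation `Link` records which connections survive this. A link
to a node from above requires the node to be live, while a link from the West also survives if its
western end is occupied. The tests in WRain guarantee that a node which ceases to be live loses no
link. When an unpointed node is vacated, the target node takes over its links, and the long link
with offset (2, -1) replaces the one from an occupied western neighbor. A covered node on the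
initial floor remains covered forever and serves as an anchor.

Since there are at most 2n covered nodes and links are short, all particles stay within O(n) columns
of the anchor. The bounded, nondecreasing `potential` therefore gives at most 21n² movements and
makes the execution stabilize. Fairness makes every particle idle in the stable configuration
(`Inv.idle_of_stable`), and extremal arguments show that such a configuration is contracted and lies
on the floor (`Inv.isFinalOn`).

For the lower bound, some coordinate takes n distinct values on the final line but varies by only
O(√n) in a compact initial configuration, while a movement changes it by at most one for a single
particle (`line_moves_ge`). -/

namespace Silbot

variable {n : ℕ}

/-! ### The possible effects of one event -/

theorem step_cases (A : Algorithm) (C : State n) (p : Fin n) :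
    (C.todo p = none ∧
      step A C p = { C with todo := Function.update C.todo p (some (look A C p)) }) ∨
    ((∃ a, C.todo p = some a) ∧ step A C p = { C with todo := Function.update C.todo p none }) ∨
    (∃ d, C.todo p = some (.expand d) ∧ ¬ EdgeBlocked C (C.pos p) d ∧
      step A C p = { C with
        dir := Function.update C.dir p (some d)
        todo := Function.update C.todo p none }) ∨
    (∃ d, C.todo p = some .contract ∧ C.dir p = some d ∧ EmptyNode C (C.pos p + d.vec) ∧
      step A C p =
        { pos := Function.update C.pos p (C.pos p + d.vec)
          dir := Function.update C.dir p none
          todo := Function.update C.todo p none }) := by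
  unfold step
  rcases h : C.todo p with _ | (_ | d | _)
  · left; simp
  · right; left; simp [act]
  · by_cases hb : EdgeBlocked C (C.pos p) d
    · right; left; simp [act, hb]
    · right; right; left; exact ⟨d, rfl, hb, by simp [act, hb]⟩
  · rcases hd : C.dir p with _ | d
    · right; left; simp [act, hd]
    · by_cases he : EmptyNode C (C.pos p + d.vec)
      · right; right; right
        exact ⟨d, rfl, rfl, he, by simp [act, hd, he]⟩
      · right; left; simp [act, hd, he]

theorem step_pos (A : Algorithm) (C : State n) (p : Fin n) :
    (step A C p).pos = C.pos ∨
    ∃ d, C.dir p = some d ∧ EmptyNode C (C.pos p + d.vec) ∧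
      (step A C p).pos = Function.update C.pos p (C.pos p + d.vec) := by
  rcases step_cases A C p with ⟨-, h⟩ | ⟨-, h⟩ | ⟨d, -, -, h⟩ | ⟨d, -, hd, he, h⟩
  · left; rw [h]
  · left; rw [h]
  · left; rw [h]
  · right; exact ⟨d, hd, he, by rw [h]⟩

theorem update_pos_injective {C : State n} (hC : Function.Injective C.pos) {p : Fin n} {v : Node}
    (hv : EmptyNode C v) : Function.Injective (Function.update C.pos p v) := by
  intro a b hab
  by_cases ha : a = p <;> by_cases hb : b = p
  · rw [ha, hb]
  · subst ha; rw [Function.update_self, Function.update_of_ne hb] at hab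
    exact absurd hab.symm (hv b)
  · subst hb; rw [Function.update_self, Function.update_of_ne ha] at hab
    exact absurd hab (hv a)
  · rw [Function.update_of_ne ha, Function.update_of_ne hb] at hab
    exact hC hab

theorem step_injective (A : Algorithm) {C : State n} (hC : Function.Injective C.pos) (p : Fin n) :
    Function.Injective (step A C p).pos := by
  rcases step_pos A C p with h | ⟨d, -, he, h⟩
  · rwa [h]
  · rw [h]; exact update_pos_injective hC he

theorem run_injective (A : Algorithm) {C : State n} (hC : Function.Injective C.pos)
    (σ : ℕ → Fin n) (t : ℕ) : Function.Injective (run A C σ t).pos := by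
  induction t with
  | zero => exact hC
  | succ t ih => exact step_injective A ih (σ t)

theorem moves_succ (A : Algorithm) (C : State n) (σ : ℕ → Fin n) (t : ℕ) :
    moves A C σ (t + 1) = moves A C σ t +
      if (run A C σ (t + 1)).pos ≠ (run A C σ t).pos then 1 else 0 := by
  classical
  unfold moves
  rw [Finset.range_add_one, Finset.filter_insert]
  split_ifs with h
  · rw [Finset.card_insert_of_notMem (by simp)]
  · rfl

/-! ### The lower bound -/

/-- A coordinate of the grid that changes by at most one along each edge. -/
def GridLipschitz (g : Node → ℤ) : Prop := ∀ v (d : Dir), |g (v + d.vec) - g v| ≤ 1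

theorem gridLipschitz_fst : GridLipschitz Prod.fst := by
  rintro v (_ | _ | _ | _ | _ | _) <;> simp [Dir.vec]

theorem gridLipschitz_snd : GridLipschitz Prod.snd := by
  rintro v (_ | _ | _ | _ | _ | _) <;> simp [Dir.vec]

/-- One movement changes a single summand, by at most one. -/
theorem sum_displacement_le_moves {g : Node → ℤ} (hg : GridLipschitz g) (A : Algorithm)
    (C : State n) (σ : ℕ → Fin n) (t : ℕ) :
    ∑ p, |g ((run A C σ t).pos p) - g (C.pos p)| ≤ moves A C σ t := by
  induction t with
  | zero => simp [run, moves]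
  | succ t ih =>
    rw [moves_succ]
    change ∑ p, |g ((step A (run A C σ t) (σ t)).pos p) - g (C.pos p)| ≤ _
    set D := run A C σ t with hD
    rcases step_pos A D (σ t) with h | ⟨d, -, he, h⟩
    · rw [h]; push_cast
      have : (0 : ℤ) ≤ if (run A C σ (t + 1)).pos ≠ D.pos then 1 else 0 := by
        split_ifs <;> simp
      linarith
    · have hne : (run A C σ (t + 1)).pos ≠ D.pos := by
        change (step A D (σ t)).pos ≠ D.pos
        rw [h]; intro h'
        have := congrFun h' (σ t)
        rw [Function.update_self] at this
        exact d.vec_ne_zero (by simpa using this)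
      rw [if_pos hne, h]
      rw [← Finset.add_sum_erase _ _ (Finset.mem_univ (σ t))] at ih ⊢
      rw [Function.update_self]
      have hrest : ∑ p ∈ Finset.univ.erase (σ t),
          |g (Function.update D.pos (σ t) (D.pos (σ t) + d.vec) p) - g (C.pos p)| =
          ∑ p ∈ Finset.univ.erase (σ t), |g (D.pos p) - g (C.pos p)| := by
        refine Finset.sum_congr rfl fun q hq => ?_
        rw [Function.update_of_ne (Finset.ne_of_mem_erase hq)]
      rw [hrest]
      have h1 := hg (D.pos (σ t)) d
      have h2 := abs_sub_le (g (D.pos (σ t) + d.vec)) (g (D.pos (σ t))) (g (C.pos (σ t)))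
      push_cast
      linarith

theorem abs_sub_le_walk_length {g : Node → ℤ} (hg : GridLipschitz g) {u v : Node}
    (w : triGrid.Walk u v) : |g u - g v| ≤ w.length := by
  induction w with
  | nil => simp
  | @cons a b c h w ih =>
    obtain ⟨d, hd⟩ := id h
    have h1 := hg a d
    rw [← hd] at h1
    have h2 := abs_sub_le (g a) (g b) (g c)
    rw [abs_sub_comm] at h1
    refine (h2.trans (add_le_add h1 ih)).trans (le_of_eq ?_)
    rw [SimpleGraph.Walk.length_cons, Nat.cast_add, Nat.cast_one, add_comm]

theorem ConnectedConf.reachable {C : State n} (hC : ConnectedConf C) (p q : Fin n) :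
    triGrid.Reachable (C.pos p) (C.pos q) :=
  (hC.preconnected ⟨_, p, rfl⟩ ⟨_, q, rfl⟩).map (SimpleGraph.Embedding.induce _).toHom

theorem ConnectedConf.abs_sub_le_dist {C : State n} (hC : ConnectedConf C) {g : Node → ℤ}
    (hg : GridLipschitz g) (p q : Fin n) :
    |g (C.pos p) - g (C.pos q)| ≤ triGrid.dist (C.pos p) (C.pos q) := by
  obtain ⟨w, hw⟩ := (hC.reachable p q).exists_walk_length_eq_dist
  rw [← hw]
  exact abs_sub_le_walk_length hg w

/-- Each direction vector has an entry ±1, and the corresponding coordinate separates the nodes of a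
line in that direction. -/
theorem Aligned.exists_coordinate {C : State n} (hC : Aligned C)
    (hinj : Function.Injective C.pos) :
    ∃ g : Node → ℤ, GridLipschitz g ∧ Function.Injective fun p => g (C.pos p) := by
  obtain ⟨v, d, h⟩ := hC
  choose k hk using h
  have key : ∀ g : Node → ℤ, (∀ a b : ℤ, g (v + a • d.vec) = g (v + b • d.vec) → a = b) →
      Function.Injective fun p => g (C.pos p) := by
    intro g hg p q hpq
    simp only [hk] at hpq
    apply hinj
    rw [hk p, hk q, hg _ _ hpq]
  cases d
  case E => exact ⟨_, gridLipschitz_fst, key _ fun a b => by simp [Dir.vec]⟩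
  case W => exact ⟨_, gridLipschitz_fst, key _ fun a b => by simp [Dir.vec]⟩
  case SE => exact ⟨_, gridLipschitz_fst, key _ fun a b => by simp [Dir.vec]⟩
  case NW => exact ⟨_, gridLipschitz_snd, key _ fun a b => by simp [Dir.vec]⟩
  case NE => exact ⟨_, gridLipschitz_snd, key _ fun a b => by simp [Dir.vec]⟩
  case SW => exact ⟨_, gridLipschitz_snd, key _ fun a b => by simp [Dir.vec]⟩

/-- Distinct integers spread out. -/
theorem card_near_le (f : Fin n → ℤ) (hf : Function.Injective f) (c : ℤ) (r : ℕ) :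
    (Finset.univ.filter fun p => |f p - c| ≤ r).card ≤ 2 * r + 1 := by
  have : (Finset.univ.filter fun p => |f p - c| ≤ r).card ≤ (Finset.Icc (c - r) (c + r)).card := by
    refine Finset.card_le_card_of_injOn f (fun p hp => ?_) hf.injOn
    simp only [Finset.coe_filter, Finset.mem_univ, true_and, Set.mem_ofPred_eq, abs_le] at hp
    simp only [Finset.coe_Icc, Set.mem_Icc]
    omega
  rw [Int.card_Icc] at this
  omega

/-- At most 2r + 1 values lie within r of c; each of the others contributes at least r. -/
theorem sum_abs_sub_ge (f : Fin n → ℤ) (hf : Function.Injective f) (c : ℤ) (r : ℕ) :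
    ((n : ℝ) - (2 * r + 1)) * r ≤ ∑ p, |((f p - c : ℤ) : ℝ)| := by
  have hcard := Finset.card_filter_add_card_filter_not (s := (Finset.univ : Finset (Fin n)))
    (fun p => |f p - c| ≤ r)
  rw [Finset.card_univ, Fintype.card_fin] at hcard
  have hn := card_near_le f hf c r
  calc ((n : ℝ) - (2 * r + 1)) * r
      ≤ ((Finset.univ.filter fun p => ¬ |f p - c| ≤ r).card : ℝ) * r := by
        refine mul_le_mul_of_nonneg_right ?_ (Nat.cast_nonneg _)
        have h1 : (n : ℝ) = ((Finset.univ.filter fun p => |f p - c| ≤ r).card : ℝ) +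
          ((Finset.univ.filter fun p => ¬ |f p - c| ≤ r).card : ℝ) := by exact_mod_cast hcard.symm
        have h2 : ((Finset.univ.filter fun p => |f p - c| ≤ r).card : ℝ) ≤ 2 * r + 1 := by
          exact_mod_cast hn
        linarith
    _ = ∑ p ∈ Finset.univ.filter (fun p => ¬ |f p - c| ≤ r), (r : ℝ) := by
        rw [Finset.sum_const, nsmul_eq_mul]
    _ ≤ ∑ p ∈ Finset.univ.filter (fun p => ¬ |f p - c| ≤ r), |((f p - c : ℤ) : ℝ)| := by
        refine Finset.sum_le_sum fun p hp => ?_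
        rw [Finset.mem_filter, not_le] at hp
        rw [← Int.cast_abs]
        exact_mod_cast hp.2.le
    _ ≤ ∑ p, |((f p - c : ℤ) : ℝ)| :=
        Finset.sum_le_sum_of_subset_of_nonneg (Finset.filter_subset _ _) fun _ _ _ => abs_nonneg _

theorem line_moves_ge {C : State n} (hC : IsInitial C) (hcomp : Compact C) (A : Algorithm)
    (σ : ℕ → Fin n) (t : ℕ) (hline : IsLine (run A C σ t)) (hn : 4096 ≤ n) :
    (1 / 64 : ℝ) * (n : ℝ) ^ 2 ≤ moves A C σ t := by
  obtain ⟨hinj, -, hconn, -⟩ := hC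
  obtain ⟨g, hg, hginj⟩ := hline.2.2.exists_coordinate (run_injective A hinj σ t)
  let p₀ : Fin n := ⟨0, by omega⟩
  -- Radius n/4 leaves about half of the particles outside, so the sum is about n²/8. The initial
  -- spread costs only O(n√n).
  have hsum := sum_abs_sub_ge _ hginj (g (C.pos p₀)) (n / 4)
  have hmov : ∑ p, |((g ((run A C σ t).pos p) - g (C.pos p) : ℤ) : ℝ)| ≤ moves A C σ t := by
    have := sum_displacement_le_moves hg A C σ t
    simp only [← Int.cast_abs]
    exact_mod_cast this
  have hstart : ∀ p, |((g (C.pos p) - g (C.pos p₀) : ℤ) : ℝ)| ≤ 2 * Real.sqrt n + 2 := by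
    intro p
    refine le_trans ?_ (hcomp p p₀)
    rw [← Int.cast_abs]
    exact_mod_cast hconn.abs_sub_le_dist hg p p₀
  have htri : ∑ p, |((g ((run A C σ t).pos p) - g (C.pos p₀) : ℤ) : ℝ)| ≤
      ∑ p, |((g ((run A C σ t).pos p) - g (C.pos p) : ℤ) : ℝ)| + n * (2 * Real.sqrt n + 2) := by
    have : (n : ℝ) * (2 * Real.sqrt n + 2) = ∑ _p : Fin n, (2 * Real.sqrt n + 2) := by
      rw [Finset.sum_const, Finset.card_univ, Fintype.card_fin, nsmul_eq_mul]
    rw [this, ← Finset.sum_add_distrib]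
    refine Finset.sum_le_sum fun p _ => ?_
    have h1 := hstart p
    push_cast at h1 ⊢
    have h2 := abs_sub_le (g ((run A C σ t).pos p) : ℝ) (g (C.pos p)) (g (C.pos p₀))
    linarith
  have hn' : (4096 : ℝ) ≤ n := by exact_mod_cast hn
  -- Since 4096 = 64², the term 2n√n is at most n²/32.
  have hs : Real.sqrt n * 64 ≤ n := by
    have h64 : (64 : ℝ) ≤ Real.sqrt n := Real.le_sqrt_of_sq_le (by linarith)
    nlinarith [Real.mul_self_sqrt (Nat.cast_nonneg (α := ℝ) n)]
  have hr1 : ((n / 4 : ℕ) : ℝ) ≤ n / 4 := by exact_mod_cast Nat.cast_div_le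
  have hr2 : (n : ℝ) / 4 - 1 ≤ ((n / 4 : ℕ) : ℝ) := by
    have : n ≤ 4 * (n / 4) + 4 := by omega
    have : (n : ℝ) ≤ 4 * ((n / 4 : ℕ) : ℝ) + 4 := by exact_mod_cast this
    linarith
  have hprod : ((n : ℝ) / 2 - 1) * (n / 4 - 1) ≤
      ((n : ℝ) - (2 * (n / 4 : ℕ) + 1)) * (n / 4 : ℕ) := by
    apply mul_le_mul <;> linarith
  nlinarith

/-! ### Compact initial configurations -/

/-- The particles fill rows of length `s` from West to East, starting with the southernmost row. -/
def blockConf (n s : ℕ) : State n where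
  pos i := (((i : ℕ) % s : ℕ), ((i : ℕ) / s : ℕ))
  dir _ := none
  todo _ := none

theorem blockConf_injective (n s : ℕ) : Function.Injective (blockConf n s).pos := by
  intro i j h
  simp only [blockConf, Prod.mk.injEq, Nat.cast_inj] at h
  apply Fin.ext
  rw [← Nat.mod_add_div (i : ℕ) s, ← Nat.mod_add_div (j : ℕ) s, h.1, h.2]

/-- Particle k has particle k - s as its South-West neighbor, or, in the lowest row, particle k - 1
as its western one. -/
theorem blockConf_connected {n s : ℕ} (hn : 0 < n) (hs : 0 < s) :
    ConnectedConf (blockConf n s) := by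
  set G := triGrid.induce (Set.range (blockConf n s).pos) with hG
  have key : ∀ (k : ℕ) (hk : k < n), G.Reachable ⟨(blockConf n s).pos ⟨k, hk⟩, _, rfl⟩
      ⟨(blockConf n s).pos ⟨0, hn⟩, _, rfl⟩ := by
    intro k
    induction k using Nat.strong_induction_on with
    | _ k ih =>
      intro hk
      rcases Nat.eq_zero_or_pos k with rfl | hpos
      · exact SimpleGraph.Reachable.refl _
      by_cases hks : s ≤ k
      · refine SimpleGraph.Reachable.trans (SimpleGraph.Adj.reachable ?_)
          (ih (k - s) (by omega) (by omega))
        have h1 : k % s = (k - s) % s := Nat.mod_eq_sub_mod hks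
        have h2 : k / s = (k - s) / s + 1 := Nat.div_eq_sub_div hs hks
        have e : (blockConf n s).pos ⟨k - s, by omega⟩ =
            (blockConf n s).pos ⟨k, hk⟩ + Dir.SW.vec := by
          simp only [blockConf, Dir.vec, h1, h2, Prod.mk_add_mk, Nat.cast_add, Nat.cast_one]
          simp
        exact ⟨Dir.SW, e⟩
      · refine SimpleGraph.Reachable.trans (SimpleGraph.Adj.reachable ?_)
          (ih (k - 1) (by omega) (by omega))
        push Not at hks
        have hks' : k - 1 < s := by omega
        have e : (blockConf n s).pos ⟨k - 1, by omega⟩ =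
            (blockConf n s).pos ⟨k, hk⟩ + Dir.W.vec := by
          simp only [blockConf, Dir.vec, Nat.mod_eq_of_lt hks, Nat.mod_eq_of_lt hks',
            Nat.div_eq_of_lt hks, Nat.div_eq_of_lt hks']
          rw [Nat.cast_sub hpos]
          rfl
        exact ⟨Dir.W, e⟩
  refine SimpleGraph.connected_iff_exists_forall_reachable _ |>.2
    ⟨⟨(blockConf n s).pos ⟨0, hn⟩, _, rfl⟩, ?_⟩
  rintro ⟨_, i, rfl⟩
  exact (key i i.2).symm

theorem exists_walk_smul (v : Node) (d : Dir) (k : ℕ) :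
    ∃ w : triGrid.Walk v (v + (k : ℤ) • d.vec), w.length = k := by
  induction k with
  | zero => exact ⟨SimpleGraph.Walk.nil.copy rfl (by simp), by simp⟩
  | succ k ih =>
    obtain ⟨w, hw⟩ := ih
    have h : triGrid.Adj (v + (k : ℤ) • d.vec) (v + ((k + 1 : ℕ) : ℤ) • d.vec) :=
      ⟨d, by push_cast; rw [add_smul, one_smul, add_assoc]⟩
    exact ⟨w.concat h, by rw [SimpleGraph.Walk.length_concat, hw]⟩

theorem exists_walk_zsmul (v : Node) (d : Dir) (k : ℤ) :
    ∃ w : triGrid.Walk v (v + k • d.vec), w.length = k.natAbs := by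
  rcases Int.natAbs_eq k with h | h
  · obtain ⟨w, hw⟩ := exists_walk_smul v d k.natAbs
    exact ⟨w.copy rfl (by rw [← h]), by simpa using hw⟩
  · obtain ⟨w, hw⟩ := exists_walk_smul v d.opp k.natAbs
    have e : v + (k.natAbs : ℤ) • d.opp.vec = v + k • d.vec := by
      rw [Dir.vec_opp, smul_neg, ← neg_smul, ← h]
    exact ⟨w.copy rfl e, by simpa using hw⟩

theorem dist_le_add (u v : Node) :
    triGrid.dist u v ≤ (v.1 - u.1).natAbs + (v.2 - u.2).natAbs := by
  obtain ⟨w₁, h₁⟩ := exists_walk_zsmul u Dir.E (v.1 - u.1)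
  obtain ⟨w₂, h₂⟩ := exists_walk_zsmul (u + (v.1 - u.1) • Dir.E.vec) Dir.NE (v.2 - u.2)
  have hv : u + (v.1 - u.1) • Dir.E.vec + (v.2 - u.2) • Dir.NE.vec = v := by
    ext <;> simp [Dir.vec]
  have := SimpleGraph.dist_le ((w₁.append w₂).copy rfl hv)
  simpa [h₁, h₂] using this

theorem blockConf_compact (n : ℕ) : Compact (blockConf n (Nat.sqrt n + 1)) := by
  intro i j
  have hs : ((Nat.sqrt n : ℕ) : ℝ) ≤ Real.sqrt n := Real.nat_sqrt_le_real_sqrt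
  have hmod : ∀ k : ℕ, k % (Nat.sqrt n + 1) ≤ Nat.sqrt n := fun k =>
    Nat.le_of_lt_succ (Nat.mod_lt _ (Nat.succ_pos _))
  have hdiv : ∀ k : Fin n, (k : ℕ) / (Nat.sqrt n + 1) ≤ Nat.sqrt n := fun k => by
    refine Nat.le_of_lt_succ (Nat.div_lt_of_lt_mul ?_)
    exact k.2.trans (Nat.lt_succ_sqrt n)
  have h := dist_le_add ((blockConf n (Nat.sqrt n + 1)).pos i)
    ((blockConf n (Nat.sqrt n + 1)).pos j)
  have h' : triGrid.dist ((blockConf n (Nat.sqrt n + 1)).pos i)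
      ((blockConf n (Nat.sqrt n + 1)).pos j) ≤ 2 * Nat.sqrt n := by
    refine h.trans ?_
    have key : ∀ a b c d m : ℕ, a ≤ m → b ≤ m → c ≤ m → d ≤ m →
        ((b : ℤ) - a).natAbs + ((d : ℤ) - c).natAbs ≤ 2 * m := by omega
    exact key _ _ _ _ _ (hmod i) (hmod j) (hdiv i) (hdiv j)
  have : (triGrid.dist ((blockConf n (Nat.sqrt n + 1)).pos i)
      ((blockConf n (Nat.sqrt n + 1)).pos j) : ℝ) ≤ 2 * Nat.sqrt n := by exact_mod_cast h'
  linarith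

theorem exists_compact_initial (hn : 0 < n) : ∃ C : State n, IsInitial C ∧ Compact C :=
  ⟨blockConf n (Nat.sqrt n + 1),
    ⟨blockConf_injective _ _, fun _ => rfl, blockConf_connected hn (Nat.succ_pos _),
      fun _ => rfl⟩, blockConf_compact n⟩

/-! ### What a particle sees -/

def Occ (C : State n) (v : Node) : Prop := ∃ p, C.pos p = v

/-- Some particle is expanded toward `v`. -/
def Ptd (C : State n) (v : Node) : Prop := ∃ p d, C.dir p = some d ∧ C.pos p + d.vec = v

theorem emptyNode_iff {C : State n} {v : Node} : EmptyNode C v ↔ ¬ Occ C v := by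
  simp [EmptyNode, Occ]

theorem nodeState_ne_empty {C : State n} {v : Node} : nodeState C v ≠ .empty ↔ Occ C v := by
  unfold nodeState
  by_cases h : ∃ p, C.pos p = v
  · rw [dif_pos h]
    refine iff_of_true ?_ h
    split <;> simp
  · rw [dif_neg h]
    exact iff_of_false (by simp) h

/-- Injectivity makes the occupant chosen in `nodeState` the only one. -/
theorem nodeState_eq_expanded {C : State n} (hC : Function.Injective C.pos) {v : Node} {d : Dir} :
    nodeState C v = .expanded d ↔ ∃ p, C.pos p = v ∧ C.dir p = some d := by
  unfold nodeState
  by_cases h : ∃ p, C.pos p = v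
  · rw [dif_pos h]
    have hp : ∀ p, C.pos p = v → p = h.choose := fun p hp => hC (hp.trans h.choose_spec.symm)
    constructor
    · intro h'
      refine ⟨h.choose, h.choose_spec, ?_⟩
      revert h'
      split <;> simp_all
    · rintro ⟨p, hpv, hpd⟩
      rw [← hp p hpv, hpd]
  · rw [dif_neg h]
    refine iff_of_false (by simp) ?_
    rintro ⟨p, hp, -⟩
    exact h ⟨p, hp⟩

theorem view_eq {C : State n} {p : Fin n} {o : Node} (ho : Visible 0 o) :
    view C p o = nodeState C (C.pos p + o) := by
  unfold view
  rw [if_pos ho]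

theorem visible_vec (d : Dir) : Visible 0 d.vec := Or.inr (Or.inl ⟨d, by simp⟩)

theorem visible_vec_add (d e : Dir) : Visible 0 (d.vec + e.vec) :=
  Or.inr (Or.inr ⟨d.vec, ⟨d, by simp⟩, e, rfl⟩)

theorem view_vec {C : State n} {p : Fin n} (d : Dir) :
    view C p d.vec = nodeState C (C.pos p + d.vec) :=
  view_eq (visible_vec d)

theorem pointed_view {C : State n} (hC : Function.Injective C.pos) {p : Fin n} {o : Node}
    (ho : ∀ d : Dir, Visible 0 (o - d.vec)) :
    Pointed (view C p) o ↔ Ptd C (C.pos p + o) := by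
  unfold Pointed Ptd
  simp only [view_eq (ho _), nodeState_eq_expanded hC]
  constructor
  · rintro ⟨d, q, hq, hd⟩
    exact ⟨q, d, hd, by rw [hq]; abel⟩
  · rintro ⟨q, d, hd, hq⟩
    exact ⟨d, q, by rw [← add_sub_assoc, ← hq]; abel, hd⟩

theorem pointed_view_zero {C : State n} (hC : Function.Injective C.pos) {p : Fin n} :
    Pointed (view C p) 0 ↔ Ptd C (C.pos p) := by
  rw [pointed_view hC fun d => by rw [zero_sub, ← Dir.vec_opp]; exact visible_vec _, add_zero]

theorem pointed_view_vec {C : State n} (hC : Function.Injective C.pos) {p : Fin n} (e : Dir) :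
    Pointed (view C p) e.vec ↔ Ptd C (C.pos p + e.vec) :=
  pointed_view hC fun d => by
    rw [sub_eq_add_neg, ← Dir.vec_opp]; exact visible_vec_add _ _

def NearAt (C : State n) (v : Node) : Prop :=
  ∃ d : Dir, ¬ Occ C (v + d.vec) ∧ Ptd C (v + d.vec)

theorem near_view {C : State n} (hC : Function.Injective C.pos) {p : Fin n} :
    Near (view C p) 0 ↔ NearAt C (C.pos p) := by
  unfold Near NearAt
  refine exists_congr fun d => ?_
  rw [zero_add, pointed_view_vec hC, view_vec, ← nodeState_ne_empty, not_not]

theorem exists_view_iff {C : State n} {p : Fin n} {l : List Node} (hl : ∀ o ∈ l, Visible 0 o) :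
    (∃ o ∈ l, view C p (0 + o) ≠ .empty) ↔ ∃ o ∈ l, Occ C (C.pos p + o) := by
  refine exists_congr fun o => and_congr_right fun ho => ?_
  rw [zero_add, view_eq (hl o ho), nodeState_ne_empty]

theorem visible_upperOffsets : ∀ o ∈ upperOffsets, Visible 0 o := by
  intro o ho
  simp only [upperOffsets, List.mem_cons, List.not_mem_nil, or_false] at ho
  rcases ho with rfl | rfl | rfl | rfl | rfl
  · exact visible_vec_add .NW .NW
  · exact visible_vec_add .NE .NW
  · exact visible_vec_add .W .NW
  · exact visible_vec .NW
  · exact visible_vec .NE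

theorem visible_lowerOffsets : ∀ o ∈ lowerOffsets, Visible 0 o := by
  intro o ho
  simp only [lowerOffsets, List.mem_cons, List.not_mem_nil, or_false] at ho
  rcases ho with rfl | rfl | rfl | rfl | rfl
  · exact visible_vec .SW
  · exact visible_vec .SE
  · exact visible_vec_add .E .SE
  · exact visible_vec_add .SW .SE
  · exact visible_vec_add .SE .SE

def UpperAt (C : State n) (v : Node) : Prop := ∃ o ∈ upperOffsets, Occ C (v + o)

def LowerAt (C : State n) (v : Node) : Prop := ∃ o ∈ lowerOffsets, Occ C (v + o)

theorem look_cases {C : State n} (hC : Function.Injective C.pos) (p : Fin n) :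
    (look WRain C p = .stay ∧ ((∃ d, C.dir p = some d ∧ Occ C (C.pos p + d.vec)) ∨
      (C.dir p = none ∧ (NearAt C (C.pos p) ∨
        ¬ Ptd C (C.pos p) ∧ (UpperAt C (C.pos p) ∨ ¬ LowerAt C (C.pos p)))))) ∨
    (look WRain C p = .contract ∧ ∃ d, C.dir p = some d ∧ ¬ Occ C (C.pos p + d.vec)) ∨
    (C.dir p = none ∧ look WRain C p = .expand .E ∧ Ptd C (C.pos p)) ∨
    (C.dir p = none ∧ look WRain C p = .expand .SE ∧ ¬ NearAt C (C.pos p) ∧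
      ¬ Ptd C (C.pos p) ∧ ¬ UpperAt C (C.pos p) ∧ LowerAt C (C.pos p)) := by
  unfold look
  rcases hd : C.dir p with _ | d
  · have hu : Upper (view C p) 0 ↔ UpperAt C (C.pos p) := exists_view_iff visible_upperOffsets
    have hl : Lower (view C p) 0 ↔ LowerAt C (C.pos p) := exists_view_iff visible_lowerOffsets
    rw [← near_view hC, ← pointed_view_zero hC, ← hu, ← hl]
    unfold WRain
    by_cases h1 : Near (view C p) 0
    · simp [h1]
    by_cases h2 : Pointed (view C p) 0
    · simp [h1, h2]
    by_cases h3 : Upper (view C p) 0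
    · simp [h1, h2, h3]
    by_cases h4 : Lower (view C p) 0
    · simp [h1, h2, h3, h4]
    · simp [h1, h2, h3, h4]
  · by_cases h : Occ C (C.pos p + d.vec)
    · have h' : ¬ EmptyNode C (C.pos p + d.vec) := by rwa [emptyNode_iff, not_not]
      simp [h, h']
    · have h' : EmptyNode C (C.pos p + d.vec) := emptyNode_iff.2 h
      simp [h, h']

/-! ### The connectivity invariant -/

/-- A node that is occupied, or about to be filled. -/
def Cov (C : State n) (v : Node) : Prop := Occ C v ∨ Ptd C v

/-- The particle is irrevocably on its way to the South-East. -/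
def Sinking (C : State n) (p : Fin n) : Prop :=
  C.dir p = some .SE ∨ C.todo p = some (.expand .SE)

/-- The node will not become uncovered by the next movement of its occupant. -/
def Live (C : State n) (v : Node) : Prop := Ptd C v ∨ ∀ p, C.pos p = v → ¬ Sinking C p

/-- The connections between covered nodes that the algorithm preserves. -/
def Link (C : State n) (a b : Node) : Prop :=
  (b = a + (1, 0) ∧ (Occ C a ∨ Live C b)) ∨
  (Live C b ∧ (b = a + (0, -1) ∨ b = a + (1, -1) ∨ (b = a + (2, -1) ∧ Occ C a)))

/-- `Link` is directed because liveness is asked of one end only; connectivity uses the equivalence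
relation that it generates. -/
def CovLink (C : State n) (a b : Node) : Prop := Cov C a ∧ Cov C b ∧ Link C a b

def CovConnected (C : State n) : Prop :=
  ∀ a b, Cov C a → Cov C b → Relation.EqvGen (CovLink C) a b

/-- The map `f` redirects a vacated node to the node that replaces it. It is the identity for all
other events. -/
theorem CovConnected.map {C C' : State n} (h : CovConnected C) (f : Node → Node)
    (hf : ∀ a b, CovLink C a b → Relation.EqvGen (CovLink C') (f a) (f b))
    (hsurj : ∀ b, Cov C' b → ∃ a, Cov C a ∧ Relation.EqvGen (CovLink C') (f a) b) :
    CovConnected C' := by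
  have hlift : ∀ a b, Relation.EqvGen (CovLink C) a b →
      Relation.EqvGen (CovLink C') (f a) (f b) := by
    intro a b hab
    induction hab with
    | rel a b h => exact hf a b h
    | refl a => exact .refl _
    | symm a b _ ih => exact .symm _ _ ih
    | trans a b c _ _ ih₁ ih₂ => exact .trans _ _ _ ih₁ ih₂
  intro a b ha hb
  obtain ⟨a', ha', ha⟩ := hsurj a ha
  obtain ⟨b', hb', hb⟩ := hsurj b hb
  exact .trans _ _ _ (.symm _ _ ha) (.trans _ _ _ (hlift _ _ (h a' b' ha' hb')) hb)

theorem occ_of_pos_eq {C C' : State n} (h : C'.pos = C.pos) : Occ C' = Occ C := by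
  funext v; simp only [Occ, h]

theorem ptd_of_eq {C C' : State n} (h : C'.pos = C.pos) (hd : C'.dir = C.dir) :
    Ptd C' = Ptd C := by
  funext v; simp only [Ptd, h, hd]

theorem cov_of_eq {C C' : State n} (h : C'.pos = C.pos) (hd : C'.dir = C.dir) :
    Cov C' = Cov C := by
  funext v; simp only [Cov, occ_of_pos_eq h, ptd_of_eq h hd]

theorem CovConnected.of_mono {C C' : State n} (h : CovConnected C)
    (hl : ∀ a b, CovLink C a b → CovLink C' a b)
    (hnew : ∀ b, Cov C' b → Cov C b ∨ ∃ a, Cov C a ∧ CovLink C' a b) : CovConnected C' := by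
  refine h.map id (fun a b hab => .rel _ _ (hl a b hab)) fun b hb => ?_
  rcases hnew b hb with hb | ⟨a, ha, hab⟩
  · exact ⟨b, hb, .refl _⟩
  · exact ⟨a, ha, .rel _ _ hab⟩

theorem CovConnected.of_not_sinking {C C' : State n} (h : CovConnected C) (hp : C'.pos = C.pos)
    (hd : C'.dir = C.dir) (hs : ∀ q, Sinking C' q → Sinking C q) : CovConnected C' := by
  have hlive : ∀ v, Live C v → Live C' v := by
    rintro v (hv | hv)
    · left; rwa [ptd_of_eq hp hd]
    · right; intro q hq hq'; rw [hp] at hq; exact hv q hq (hs q hq')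
  refine h.of_mono ?_ fun b hb => Or.inl (by rwa [cov_of_eq hp hd] at hb)
  rintro a b ⟨ha, hb, hab⟩
  refine ⟨by rwa [cov_of_eq hp hd], by rwa [cov_of_eq hp hd], ?_⟩
  unfold Link at *
  rw [occ_of_pos_eq hp]
  have := hlive b
  tauto

/-- Only links ending at the node of `p` are at risk. Those from above start at nodes excluded by
`UpperAt`. The one from the West survives because its start is occupied: a covered but empty
neighbor would give `NearAt`. -/
theorem CovConnected.of_sinking {C C' : State n} (h : CovConnected C) (hp : C'.pos = C.pos)
    (hd : C'.dir = C.dir) {p : Fin n} (hs : ∀ q, q ≠ p → Sinking C' q → Sinking C q)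
    (hnear : ¬ NearAt C (C.pos p)) (hup : ¬ UpperAt C (C.pos p)) : CovConnected C' := by
  have hlive : ∀ v, v ≠ C.pos p → Live C v → Live C' v := by
    rintro v hne (hv | hv)
    · left; rwa [ptd_of_eq hp hd]
    · right; intro q hq hq'; rw [hp] at hq
      refine hv q hq (hs q ?_ hq')
      rintro rfl; exact hne hq.symm
  have hocc : ∀ o ∈ upperOffsets, ¬ Occ C (C.pos p + o) := fun o ho ho' => hup ⟨o, ho, ho'⟩
  have hcov : ∀ d : Dir, Cov C (C.pos p + d.vec) → Occ C (C.pos p + d.vec) := by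
    rintro d (h' | h')
    · exact h'
    · by_contra h''; exact hnear ⟨d, h'', h'⟩
  refine h.of_mono ?_ fun b hb => Or.inl (by rwa [cov_of_eq hp hd] at hb)
  rintro a b ⟨ha, hb, hab⟩
  refine ⟨by rwa [cov_of_eq hp hd], by rwa [cov_of_eq hp hd], ?_⟩
  unfold Link at *
  rw [occ_of_pos_eq hp]
  by_cases hbv : b = C.pos p
  · rw [hbv] at hab
    rcases hab with ⟨hab, -⟩ | ⟨-, hab | hab | ⟨hab, hoa⟩⟩
    · left
      have e : a = C.pos p + Dir.W.vec := by rw [hab]; simp [Dir.vec, add_assoc]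
      refine ⟨by rw [hbv, hab], Or.inl ?_⟩
      rw [e]; exact hcov _ (e ▸ ha)
    · exfalso
      have e : a = C.pos p + Dir.NE.vec := by rw [hab]; simp [Dir.vec, add_assoc]
      rw [e] at ha
      exact hocc _ (by simp [upperOffsets, Dir.vec]) (hcov _ ha)
    · exfalso
      have e : a = C.pos p + Dir.NW.vec := by rw [hab]; simp [Dir.vec, add_assoc]
      rw [e] at ha
      exact hocc _ (by simp [upperOffsets, Dir.vec]) (hcov _ ha)
    · exfalso
      have e : a = C.pos p + (-2, 1) := by rw [hab]; simp [add_assoc]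
      rw [e] at hoa
      exact hocc _ (by simp [upperOffsets]) hoa
  · have := hlive b hbv
    tauto

/-! ### Expansions -/

/-- No link is lost, since the particle already counted as sinking if `d` is South-East. The target
is now pointed, hence live, and so linked to the node of `p`. -/
theorem CovConnected.expand {C C' : State n} (h : CovConnected C) {p : Fin n} {d : Dir}
    (hd : d = .E ∨ d = .SE) (htodo : C.todo p = some (.expand d)) (hdir : C.dir p = none)
    (hC' : C' = { C with dir := Function.update C.dir p (some d)
                         todo := Function.update C.todo p none }) : CovConnected C' := by
  have hpos : C'.pos = C.pos := by rw [hC']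
  have hocc := occ_of_pos_eq hpos
  have hptd : ∀ v, Ptd C v → Ptd C' v := by
    rintro v ⟨q, e, hq, hv⟩
    have hqp : q ≠ p := by rintro rfl; rw [hdir] at hq; cases hq
    exact ⟨q, e, by rw [hC']; simpa [hqp] using hq, by rw [hpos, hv]⟩
  have hptdp : Ptd C' (C.pos p + d.vec) := ⟨p, d, by rw [hC']; simp, by rw [hpos]⟩
  have hptd' : ∀ v, Ptd C' v → Ptd C v ∨ v = C.pos p + d.vec := by
    rintro v ⟨q, e, hq, hv⟩
    by_cases hqp : q = p
    · subst hqp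
      rw [hC'] at hq
      simp only [Function.update_self, Option.some.injEq] at hq
      right; rw [← hv, hpos, hq]
    · left
      rw [hC'] at hq
      simp only [Function.update_of_ne hqp] at hq
      exact ⟨q, e, hq, by rw [← hpos, hv]⟩
  have hsink : ∀ q, Sinking C' q → Sinking C q := by
    intro q hq
    by_cases hqp : q = p
    · subst hqp
      rcases hq with hq | hq
      · rw [hC'] at hq
        simp only [Function.update_self, Option.some.injEq] at hq
        right; rw [htodo, hq]
      · rw [hC'] at hq
        simp at hq
    · simpa [Sinking, hC', hqp] using hq
  have hlive : ∀ v, Live C v → Live C' v := by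
    rintro v (hv | hv)
    · exact Or.inl (hptd v hv)
    · right; intro q hq hq'; rw [hpos] at hq; exact hv q hq (hsink q hq')
  have hcov : ∀ v, Cov C v → Cov C' v := by
    rintro v (hv | hv)
    · left; rwa [hocc]
    · right; exact hptd v hv
  refine h.of_mono ?_ ?_
  · rintro a b ⟨ha, hb, hab⟩
    refine ⟨hcov a ha, hcov b hb, ?_⟩
    unfold Link at *
    rw [hocc]
    have := hlive b
    tauto
  · rintro b (hb | hb)
    · left; left; rwa [hocc] at hb
    · rcases hptd' b hb with hb' | rfl
      · left; right; exact hb'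
      · right
        refine ⟨C.pos p, Or.inl ⟨p, rfl⟩, hcov _ (Or.inl ⟨p, rfl⟩), Or.inr hb, ?_⟩
        rcases hd with rfl | rfl
        · left; exact ⟨rfl, Or.inr (Or.inl hb)⟩
        · right; exact ⟨Or.inl hb, Or.inr (Or.inl rfl)⟩

/-! ### Contractions -/

/-- The state after the contraction of `p` toward `d`. -/
def contractState (C : State n) (p : Fin n) (d : Dir) : State n where
  pos := Function.update C.pos p (C.pos p + d.vec)
  dir := Function.update C.dir p none
  todo := Function.update C.todo p none

section Contract

variable {C : State n} {p : Fin n} {d : Dir}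

theorem occ_contract {v : Node} (hv : Occ C v) (hne : v ≠ C.pos p) :
    Occ (contractState C p d) v := by
  obtain ⟨q, rfl⟩ := hv
  have hqp : q ≠ p := by rintro rfl; exact hne rfl
  exact ⟨q, by simp [contractState, hqp]⟩

theorem occ_contract_target : Occ (contractState C p d) (C.pos p + d.vec) :=
  ⟨p, by simp [contractState]⟩

theorem not_sinking_contract : ¬ Sinking (contractState C p d) p := by
  simp [Sinking, contractState]

theorem sinking_contract {q : Fin n} (hq : Sinking (contractState C p d) q) : Sinking C q := by
  have hqp : q ≠ p := by rintro rfl; exact not_sinking_contract hq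
  simpa [Sinking, contractState, hqp] using hq

theorem ptd_contract (hd : C.dir p = some d) {v : Node} (hv : Ptd C v)
    (hne : v ≠ C.pos p + d.vec) : Ptd (contractState C p d) v := by
  obtain ⟨q, e, hq, rfl⟩ := hv
  have hqp : q ≠ p := by
    rintro rfl
    rw [hd, Option.some.injEq] at hq
    exact hne (by rw [hq])
  exact ⟨q, e, by simpa [contractState, hqp] using hq, by simp [contractState, hqp]⟩

theorem ptd_contract_pos (hd : C.dir p = some d) (hv : Ptd C (C.pos p)) :
    Ptd (contractState C p d) (C.pos p) :=
  ptd_contract hd hv fun h => d.vec_ne_zero (by simpa using h)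

theorem ptd_of_contract {v : Node} (hv : Ptd (contractState C p d) v) : Ptd C v := by
  obtain ⟨q, e, hq, hv⟩ := hv
  have hqp : q ≠ p := by rintro rfl; simp [contractState] at hq
  exact ⟨q, e, by simpa [contractState, hqp] using hq, by simpa [contractState, hqp] using hv⟩

theorem cov_of_contract (hd : C.dir p = some d) {v : Node} (hv : Cov (contractState C p d) v) :
    Cov C v := by
  rcases hv with ⟨q, hq⟩ | hv
  · by_cases hqp : q = p
    · subst hqp
      right; exact ⟨q, d, hd, by simpa [contractState] using hq⟩
    · left; exact ⟨q, by simpa [contractState, hqp] using hq⟩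
  · exact Or.inr (ptd_of_contract hv)

theorem cov_contract (hd : C.dir p = some d) {v : Node} (hv : Cov C v)
    (hne : v = C.pos p → Ptd C v) : Cov (contractState C p d) v := by
  by_cases h1 : v = C.pos p
  · right; rw [h1] at hne ⊢; exact ptd_contract_pos hd (hne rfl)
  by_cases h2 : v = C.pos p + d.vec
  · left; rw [h2]; exact occ_contract_target
  rcases hv with hv | hv
  · exact Or.inl (occ_contract hv h1)
  · exact Or.inr (ptd_contract hd hv h2)

theorem live_contract_target (he : EmptyNode C (C.pos p + d.vec)) :
    Live (contractState C p d) (C.pos p + d.vec) := by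
  right
  intro q hq hq'
  have hqp : q ≠ p := by rintro rfl; exact not_sinking_contract hq'
  exact he q (by simpa [contractState, hqp] using hq)

theorem live_contract (hd : C.dir p = some d) (he : EmptyNode C (C.pos p + d.vec)) {v : Node}
    (hv : Live C v) : Live (contractState C p d) v := by
  by_cases h2 : v = C.pos p + d.vec
  · rw [h2]; exact live_contract_target he
  rcases hv with hv | hv
  · exact Or.inl (ptd_contract hd hv h2)
  · right
    intro q hq hq'
    have hqp : q ≠ p := by rintro rfl; exact not_sinking_contract hq'
    exact hv q (by simpa [contractState, hqp] using hq) (sinking_contract hq')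

theorem covLink_contract (hd : C.dir p = some d) (he : EmptyNode C (C.pos p + d.vec))
    {a b : Node} (hab : CovLink C a b) (ha : a ≠ C.pos p) (hb : b = C.pos p → Ptd C b) :
    CovLink (contractState C p d) a b := by
  obtain ⟨hca, hcb, hab⟩ := hab
  refine ⟨cov_contract hd hca fun h => absurd h ha, cov_contract hd hcb hb, ?_⟩
  have h1 : Occ C a → Occ (contractState C p d) a := fun h => occ_contract h ha
  have h2 : Live C b → Live (contractState C p d) b := live_contract hd he
  unfold Link at *
  tauto

theorem cov_contract_target : Cov (contractState C p d) (C.pos p + d.vec) :=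
  Or.inl occ_contract_target

/-- The old node stays covered, and only links that used its occupancy can break. Each is replaced
by a detour through the live target node. -/
theorem CovConnected.contract_pointed (h : CovConnected C) (hd : C.dir p = some d)
    (hdE : d = .E ∨ d = .SE) (he : EmptyNode C (C.pos p + d.vec)) (hp : Ptd C (C.pos p)) :
    CovConnected (contractState C p d) := by
  have hcp : Cov (contractState C p d) (C.pos p) := Or.inr (ptd_contract_pos hd hp)
  have hlw : Live (contractState C p d) (C.pos p + d.vec) := live_contract_target he
  have hcw : Cov (contractState C p d) (C.pos p + d.vec) := cov_contract_target
  have hpw : CovLink (contractState C p d) (C.pos p) (C.pos p + d.vec) := by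
    refine ⟨hcp, hcw, ?_⟩
    rcases hdE with rfl | rfl
    · exact Or.inl ⟨rfl, Or.inr hlw⟩
    · exact Or.inr ⟨hlw, Or.inr (Or.inl rfl)⟩
  refine h.map id ?_ fun b hb => ⟨b, cov_of_contract hd hb, .refl _⟩
  intro a b hab
  by_cases ha : a = C.pos p
  swap
  · exact .rel _ _ (covLink_contract hd he hab ha fun h => h ▸ hp)
  subst ha
  obtain ⟨-, hcb, hab⟩ := hab
  have hcb' := cov_contract hd hcb (fun h => h ▸ hp)
  have hl : Live C b → Live (contractState C p d) b := live_contract hd he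
  rcases hab with ⟨rfl, hab⟩ | ⟨hlb, rfl | rfl | ⟨rfl, hoa⟩⟩
  · rcases hdE with rfl | rfl
    · exact .rel _ _ hpw
    · refine .trans _ _ _ (.rel _ _ hpw) (.symm _ _ (.rel _ _ ⟨hcb', hcw, Or.inr ⟨hlw, Or.inl ?_⟩⟩))
      simp [Dir.vec, add_assoc]
  · exact .rel _ _ ⟨hcp, hcb', Or.inr ⟨hl hlb, Or.inl rfl⟩⟩
  · exact .rel _ _ ⟨hcp, hcb', Or.inr ⟨hl hlb, Or.inr (Or.inl rfl)⟩⟩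
  · refine .trans _ _ _ (.rel _ _ hpw) (.rel _ _ ⟨hcw, hcb', ?_⟩)
    rcases hdE with rfl | rfl
    · exact Or.inr ⟨hl hlb, Or.inr (Or.inl (by simp [Dir.vec, add_assoc]))⟩
    · exact Or.inl ⟨by simp [Dir.vec, add_assoc], Or.inr (hl hlb)⟩

/-- The old node is no longer covered and is redirected to the target. It was not live, so its only
incoming link comes from an occupied western neighbor, which then reaches the target by the offset
(2, -1). Every outgoing link ended at the target or at a node now linked with it. -/
theorem CovConnected.contract_unpointed (h : CovConnected C) (hinj : Function.Injective C.pos)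
    (hd : C.dir p = some .SE) (he : EmptyNode C (C.pos p + Dir.SE.vec))
    (hp : ¬ Ptd C (C.pos p)) : CovConnected (contractState C p .SE) := by
  have hlw : Live (contractState C p .SE) (C.pos p + Dir.SE.vec) := live_contract_target he
  have hcw : Cov (contractState C p .SE) (C.pos p + Dir.SE.vec) := cov_contract_target
  have hnot : ¬ Live C (C.pos p) := by
    rintro (h' | h')
    · exact hp h'
    · exact h' p rfl (Or.inl hd)
  have hwne : C.pos p + Dir.SE.vec ≠ C.pos p := fun h => Dir.SE.vec_ne_zero (by simpa using h)
  have hself : ∀ b, Link C (C.pos p) b → b ≠ C.pos p := by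
    rintro b (⟨rfl, -⟩ | ⟨-, rfl | rfl | ⟨rfl, -⟩⟩) <;> simp [Prod.ext_iff]
  refine h.map (fun x => if x = C.pos p then C.pos p + Dir.SE.vec else x) ?_ ?_
  · intro a b hab
    by_cases hb : b = C.pos p
    · subst hb
      have ha : a ≠ C.pos p := by rintro rfl; exact hself _ hab.2.2 rfl
      rw [if_pos rfl, if_neg ha]
      obtain ⟨hca, -, ⟨hab, hoa | hl⟩ | ⟨hl, -⟩⟩ := hab
      · refine .rel _ _ ⟨cov_contract hd hca fun h => absurd h ha, hcw, Or.inr ⟨hlw, ?_⟩⟩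
        refine Or.inr (Or.inr ⟨?_, occ_contract hoa ha⟩)
        rw [hab]; simp [Dir.vec, add_assoc]
      · exact absurd hl hnot
      · exact absurd hl hnot
    · rw [if_neg hb]
      by_cases ha : a = C.pos p
      swap
      · rw [if_neg ha]
        exact .rel _ _ (covLink_contract hd he hab ha fun h => absurd h hb)
      subst ha
      rw [if_pos rfl]
      obtain ⟨-, hcb, hab⟩ := hab
      have hcb' : Cov (contractState C p .SE) b := cov_contract hd hcb fun h => absurd h hb
      have hl : Live C b → Live (contractState C p .SE) b := live_contract hd he
      rcases hab with ⟨rfl, hab⟩ | ⟨hlb, rfl | rfl | ⟨rfl, hoa⟩⟩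
      · refine .symm _ _ (.rel _ _ ⟨hcb', hcw, Or.inr ⟨hlw, Or.inl ?_⟩⟩)
        simp [Dir.vec, add_assoc]
      · refine .symm _ _ (.rel _ _ ⟨hcb', hcw, Or.inl ⟨?_, Or.inr hlw⟩⟩)
        simp [Dir.vec, add_assoc]
      · exact .refl _
      · exact .rel _ _ ⟨hcw, hcb', Or.inl ⟨by simp [Dir.vec, add_assoc], Or.inr (hl hlb)⟩⟩
  · intro b hb
    have hbp : b ≠ C.pos p := by
      rintro rfl
      rcases hb with ⟨q, hq⟩ | hb
      · by_cases hqp : q = p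
        · subst hqp
          exact hwne (by simpa [contractState] using hq)
        · exact hqp (hinj (by simpa [contractState, hqp] using hq))
      · exact hp (ptd_of_contract hb)
    exact ⟨b, cov_of_contract hd hb, by rw [if_neg hbp]; exact .refl _⟩

end Contract

/-! ### The invariant of the executions of WRain -/

/-- By `ptd_of_E`, a particle leaving eastward never uncovers its node, so only South-East moves
can. The node `v₀` is a fixed anchor on the floor, needed to bound drift and to identify the final
row. -/
structure Inv (y : ℤ) (v₀ : Node) (C : State n) : Prop where
  inj : Function.Injective C.pos
  dir_eq : ∀ p d, C.dir p = some d → d = .E ∨ d = .SE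
  expand_eq : ∀ p d, C.todo p = some (.expand d) → C.dir p = none ∧ (d = .E ∨ d = .SE)
  ptd_of_E : ∀ p, C.dir p = some .E ∨ C.todo p = some (.expand .E) → Ptd C (C.pos p)
  floor_le : ∀ p, y ≤ (C.pos p).2
  floor_lt : ∀ p, Sinking C p → y < (C.pos p).2
  base : v₀.2 = y
  cov_base : Cov C v₀
  conn : CovConnected C

theorem LowerAt.floor_lt {C : State n} {y : ℤ} (hy : ∀ p, y ≤ (C.pos p).2) {v : Node}
    (h : LowerAt C v) : y < v.2 := by
  obtain ⟨o, ho, q, hq⟩ := h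
  have h1 := hy q
  rw [hq] at h1
  have h2 : o.2 < 0 := by
    simp only [lowerOffsets, List.mem_cons, List.not_mem_nil, or_false] at ho
    rcases ho with rfl | rfl | rfl | rfl | rfl <;> simp
  simp only [Prod.snd_add] at h1
  omega

theorem Inv.of_todo {C C' : State n} {y : ℤ} {v₀ : Node} (h : Inv y v₀ C) (hp : C'.pos = C.pos)
    (hd : C'.dir = C.dir)
    (htodo : ∀ q d, C'.todo q = some (.expand d) → C.todo q = some (.expand d) ∨
      (C.dir q = none ∧ ((d = .E ∧ Ptd C (C.pos q)) ∨ (d = .SE ∧ y < (C.pos q).2))))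
    (hconn : CovConnected C') : Inv y v₀ C' where
  inj := by rw [hp]; exact h.inj
  dir_eq := by rw [hd]; exact h.dir_eq
  expand_eq := by
    intro q d hq
    rw [hd]
    rcases htodo q d hq with hq | ⟨hq, ⟨hq', -⟩ | ⟨hq', -⟩⟩
    · exact h.expand_eq q d hq
    · exact ⟨hq, Or.inl hq'⟩
    · exact ⟨hq, Or.inr hq'⟩
  ptd_of_E := by
    intro q hq
    rw [hd] at hq
    rw [ptd_of_eq hp hd, hp]
    rcases hq with hq | hq
    · exact h.ptd_of_E q (Or.inl hq)
    · rcases htodo q _ hq with hq | ⟨-, ⟨-, hq⟩ | ⟨hq, -⟩⟩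
      · exact h.ptd_of_E q (Or.inr hq)
      · exact hq
      · cases hq
  floor_le := by rw [hp]; exact h.floor_le
  floor_lt := by
    intro q hq
    rw [hp]
    rcases hq with hq | hq
    · exact h.floor_lt q (Or.inl (by rwa [hd] at hq))
    · rcases htodo q _ hq with hq | ⟨-, ⟨hq, -⟩ | ⟨-, hq⟩⟩
      · exact h.floor_lt q (Or.inr hq)
      · cases hq
      · exact hq
  base := h.base
  cov_base := by rw [cov_of_eq hp hd]; exact h.cov_base
  conn := hconn

theorem Inv.look {C : State n} {y : ℤ} {v₀ : Node} (h : Inv y v₀ C) (p : Fin n) :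
    Inv y v₀ { C with todo := Function.update C.todo p (some (look WRain C p)) } := by
  refine h.of_todo rfl rfl ?_ ?_
  · intro q d hq
    by_cases hqp : q = p
    · subst hqp
      right
      simp only [Function.update_self, Option.some.injEq] at hq
      rcases look_cases h.inj q with ⟨h1, -⟩ | ⟨h1, -⟩ | ⟨h0, h1, h2⟩ | ⟨h0, h1, -, -, -, h2⟩
      · rw [h1] at hq; cases hq
      · rw [h1] at hq; cases hq
      · rw [h1] at hq; cases hq; exact ⟨h0, Or.inl ⟨rfl, h2⟩⟩
      · rw [h1] at hq; cases hq; exact ⟨h0, Or.inr ⟨rfl, h2.floor_lt h.floor_le⟩⟩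
    · left; simpa [hqp] using hq
  · have hne : ∀ q, q ≠ p → Sinking
        { C with todo := Function.update C.todo p (some (Silbot.look WRain C p)) } q →
        Sinking C q := by
      intro q hqp hq
      simpa [Sinking, hqp] using hq
    by_cases hSE : Silbot.look WRain C p = .expand .SE
    · rcases look_cases h.inj p with ⟨h1, -⟩ | ⟨h1, -⟩ | ⟨-, h1, -⟩ | ⟨-, -, h2, -, h3, -⟩
      · rw [h1] at hSE; cases hSE
      · rw [h1] at hSE; cases hSE
      · rw [h1] at hSE; cases hSE
      · exact h.conn.of_sinking rfl rfl hne h2 h3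
    · refine h.conn.of_not_sinking rfl rfl fun q hq => ?_
      by_cases hqp : q = p
      · subst hqp
        rcases hq with hq | hq
        · exact Or.inl hq
        · simp only [Function.update_self, Option.some.injEq] at hq
          exact absurd hq hSE
      · exact hne q hqp hq

theorem Inv.forget {C : State n} {y : ℤ} {v₀ : Node} (h : Inv y v₀ C) (p : Fin n) :
    Inv y v₀ { C with todo := Function.update C.todo p none } := by
  have key : ∀ q d, Function.update C.todo p none q = some (.expand d) →
      C.todo q = some (.expand d) := by
    intro q d hq
    by_cases hqp : q = p
    · subst hqp; simp at hq
    · simpa [hqp] using hq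
  refine h.of_todo rfl rfl (fun q d hq => Or.inl (key q d hq))
    (h.conn.of_not_sinking rfl rfl ?_)
  rintro q (hq | hq)
  · exact Or.inl hq
  · exact Or.inr (key q _ hq)

theorem Inv.expand {C : State n} {y : ℤ} {v₀ : Node} (h : Inv y v₀ C) {p : Fin n} {d : Dir}
    (hp : C.todo p = some (.expand d)) :
    Inv y v₀ { C with dir := Function.update C.dir p (some d)
                      todo := Function.update C.todo p none } := by
  obtain ⟨hdir, hdE⟩ := h.expand_eq p d hp
  set C' : State n := { C with dir := Function.update C.dir p (some d)
                               todo := Function.update C.todo p none } with hC'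
  have hdp : C'.dir p = some d := by simp [hC']
  have htp : C'.todo p = none := by simp [hC']
  have hdq : ∀ q, q ≠ p → C'.dir q = C.dir q := fun q hq => by simp [hC', hq]
  have htq : ∀ q, q ≠ p → C'.todo q = C.todo q := fun q hq => by simp [hC', hq]
  have hptd : ∀ v, Ptd C v → Ptd C' v := by
    rintro v ⟨q, e, hq, hv⟩
    have hqp : q ≠ p := by rintro rfl; rw [hdir] at hq; cases hq
    exact ⟨q, e, by rw [hdq q hqp, hq], hv⟩
  refine ⟨h.inj, ?_, ?_, ?_, h.floor_le, ?_, h.base, h.cov_base.imp id (hptd _),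
    h.conn.expand hdE hp hdir hC'⟩
  · intro q e hq
    by_cases hqp : q = p
    · subst hqp; rw [hdp] at hq; cases hq; exact hdE
    · rw [hdq q hqp] at hq; exact h.dir_eq q e hq
  · intro q e hq
    by_cases hqp : q = p
    · subst hqp; rw [htp] at hq; cases hq
    · rw [htq q hqp] at hq; rw [hdq q hqp]; exact h.expand_eq q e hq
  · intro q hq
    apply hptd
    by_cases hqp : q = p
    · subst hqp
      rw [hdp, htp] at hq
      rcases hq with hq | hq
      · cases hq; exact h.ptd_of_E q (Or.inr hp)
      · cases hq
    · rw [hdq q hqp, htq q hqp] at hq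
      exact h.ptd_of_E q hq
  · intro q hq
    refine h.floor_lt q ?_
    unfold Sinking at hq ⊢
    by_cases hqp : q = p
    · subst hqp
      rw [hdp, htp] at hq
      rcases hq with hq | hq
      · cases hq; exact Or.inr hp
      · cases hq
    · rwa [hdq q hqp, htq q hqp] at hq

theorem Inv.contract {C : State n} {y : ℤ} {v₀ : Node} (h : Inv y v₀ C) {p : Fin n} {d : Dir}
    (hd : C.dir p = some d) (he : EmptyNode C (C.pos p + d.vec)) :
    Inv y v₀ (contractState C p d) := by
  have hdE := h.dir_eq p d hd
  have hpp : (contractState C p d).pos p = C.pos p + d.vec := by simp [contractState]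
  have hpq : ∀ q, q ≠ p → (contractState C p d).pos q = C.pos q :=
    fun q hq => by simp [contractState, hq]
  have hdp : (contractState C p d).dir p = none := by simp [contractState]
  have htp : (contractState C p d).todo p = none := by simp [contractState]
  have hdq : ∀ q, q ≠ p → (contractState C p d).dir q = C.dir q :=
    fun q hq => by simp [contractState, hq]
  have htq : ∀ q, q ≠ p → (contractState C p d).todo q = C.todo q :=
    fun q hq => by simp [contractState, hq]
  have hlt : ¬ Ptd C (C.pos p) → d = .SE ∧ y < (C.pos p).2 := by
    intro hp
    rcases hdE with rfl | rfl
    · exact absurd (h.ptd_of_E p (Or.inl hd)) hp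
    · exact ⟨rfl, h.floor_lt p (Or.inl hd)⟩
  refine ⟨update_pos_injective h.inj he, ?_, ?_, ?_, ?_, ?_, h.base, ?_, ?_⟩
  · intro q e hq
    by_cases hqp : q = p
    · subst hqp; rw [hdp] at hq; cases hq
    · rw [hdq q hqp] at hq; exact h.dir_eq q e hq
  · intro q e hq
    by_cases hqp : q = p
    · subst hqp; rw [htp] at hq; cases hq
    · rw [htq q hqp] at hq; rw [hdq q hqp]; exact h.expand_eq q e hq
  · intro q hq
    by_cases hqp : q = p
    · subst hqp; rw [hdp, htp] at hq; rcases hq with hq | hq <;> cases hq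
    · rw [hdq q hqp, htq q hqp] at hq
      rw [hpq q hqp]
      -- The particle pointing at `q` cannot be the one contracting, since its target is occupied by
      -- `q`.
      exact ptd_contract hd (h.ptd_of_E q hq) (he q)
  · intro q
    by_cases hqp : q = p
    · subst hqp
      rw [hpp]
      have h1 := h.floor_le q
      rcases hdE with rfl | rfl
      · simpa [Dir.vec] using h1
      · have := h.floor_lt q (Or.inl hd)
        simp only [Dir.vec, Prod.snd_add]
        omega
    · rw [hpq q hqp]; exact h.floor_le q
  · intro q hq
    have hqp : q ≠ p := by rintro rfl; exact not_sinking_contract hq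
    rw [hpq q hqp]
    exact h.floor_lt q (sinking_contract hq)
  · refine cov_contract hd h.cov_base fun hv => ?_
    -- Vacating an unpointed node is a South-East move from strictly above the floor, so it cannot
    -- uncover `v₀`.
    by_contra hp
    rw [hv] at hp
    have := (hlt hp).2
    rw [← hv, h.base] at this
    exact lt_irrefl _ this
  · by_cases hp : Ptd C (C.pos p)
    · exact h.conn.contract_pointed hd hdE he hp
    · obtain ⟨rfl, -⟩ := hlt hp
      exact h.conn.contract_unpointed h.inj hd he hp

theorem Inv.step {C : State n} {y : ℤ} {v₀ : Node} (h : Inv y v₀ C) (p : Fin n) :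
    Inv y v₀ (step WRain C p) := by
  rcases step_cases WRain C p with ⟨-, hs⟩ | ⟨-, hs⟩ | ⟨d, hp, -, hs⟩ | ⟨d, -, hd, he, hs⟩ <;>
    rw [hs]
  · exact h.look p
  · exact h.forget p
  · exact h.expand hp
  · exact h.contract hd he

theorem Inv.run {C : State n} {y : ℤ} {v₀ : Node} (h : Inv y v₀ C) (σ : ℕ → Fin n) (t : ℕ) :
    Inv y v₀ (run WRain C σ t) := by
  induction t with
  | zero => exact h
  | succ t ih => exact ih.step (σ t)

/-- Nothing is sinking, so all nodes are live and every grid edge between occupied nodes is a link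
in one of its two orientations. -/
theorem IsInitial.inv {C : State n} (hC : IsInitial C) (p₀ : Fin n)
    (hp₀ : ∀ p, (C.pos p₀).2 ≤ (C.pos p).2) : Inv (C.pos p₀).2 (C.pos p₀) C := by
  obtain ⟨hinj, hdir, hconn, htodo⟩ := hC
  have hsink : ∀ p, ¬ Sinking C p := by
    rintro p (h | h)
    · rw [hdir p] at h; cases h
    · rw [htodo p] at h; cases h
  have hlive : ∀ v, Live C v := fun v => Or.inr fun p _ => hsink p
  have hocc : ∀ v, Cov C v → Occ C v := by
    rintro v (h | ⟨q, d, hq, -⟩)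
    · exact h
    · rw [hdir q] at hq; cases hq
  refine ⟨hinj, ?_, ?_, ?_, hp₀, fun p h => absurd h (hsink p), rfl, Or.inl ⟨p₀, rfl⟩, ?_⟩
  · intro p d h; rw [hdir p] at h; cases h
  · intro p d h; rw [htodo p] at h; cases h
  · rintro p (h | h)
    · rw [hdir p] at h; cases h
    · rw [htodo p] at h; cases h
  · intro a b ha hb
    obtain ⟨w⟩ := hconn.preconnected ⟨a, hocc a ha⟩ ⟨b, hocc b hb⟩
    have key : ∀ u v : Set.range C.pos, (triGrid.induce (Set.range C.pos)).Walk u v →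
        Relation.EqvGen (CovLink C) u.1 v.1 := by
      intro u v w
      induction w with
      | nil => exact .refl _
      | @cons u v w h _ ih =>
        refine .trans _ _ _ ?_ ih
        obtain ⟨d, hd⟩ := h
        have hd : v.1 = u.1 + d.vec := hd
        have hu : Cov C u.1 := Or.inl u.2
        have hv : Cov C v.1 := Or.inl v.2
        have hd' : u.1 = v.1 + d.opp.vec := by rw [hd, Dir.vec_opp]; abel
        cases d
        · exact .rel _ _ ⟨hu, hv, Or.inl ⟨hd, Or.inr (hlive _)⟩⟩
        · exact .symm _ _ (.rel _ _ ⟨hv, hu, Or.inr ⟨hlive _, Or.inl hd'⟩⟩)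
        · exact .symm _ _ (.rel _ _ ⟨hv, hu, Or.inr ⟨hlive _, Or.inr (Or.inl hd')⟩⟩)
        · exact .symm _ _ (.rel _ _ ⟨hv, hu, Or.inl ⟨hd', Or.inr (hlive _)⟩⟩)
        · exact .rel _ _ ⟨hu, hv, Or.inr ⟨hlive _, Or.inl hd⟩⟩
        · exact .rel _ _ ⟨hu, hv, Or.inr ⟨hlive _, Or.inr (Or.inl hd)⟩⟩
    exact key _ _ w

/-! ### The horizontal extent of a configuration -/

/-- Steps of width at most two cannot cross a strip of two columns that misses `S`. If the bound
failed, `S.card + 1` disjoint strips between `a` and `b` would all meet `S`. -/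
theorem fst_sub_le_of_eqvGen {R : Node → Node → Prop} {S : Finset Node}
    (hR : ∀ a b, R a b → a ∈ S ∧ b ∈ S ∧ |b.1 - a.1| ≤ 2) {a b : Node}
    (h : Relation.EqvGen R a b) : b.1 - a.1 ≤ 2 * S.card + 1 := by
  by_contra! hlt
  have key : ∀ k : ℕ, k ≤ S.card → ∃ s ∈ S, a.1 + 2 * k ≤ s.1 ∧ s.1 < a.1 + 2 * k + 2 := by
    intro k hk
    by_contra! hnone
    have hinv : ∀ x y, Relation.EqvGen R x y →
        (x.1 < a.1 + 2 * k + 2 ↔ y.1 < a.1 + 2 * k + 2) := by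
      intro x y hxy
      induction hxy with
      | rel x y h =>
        obtain ⟨hx, hy, hd⟩ := hR x y h
        have h1 := hnone x hx
        have h2 := hnone y hy
        rw [abs_le] at hd
        omega
      | refl x => exact Iff.rfl
      | symm x y _ ih => exact ih.symm
      | trans x y z _ _ ih₁ ih₂ => exact ih₁.trans ih₂
    have := hinv a b h
    omega
  choose! f hf using key
  have hinj : Set.InjOn f (Finset.range (S.card + 1)) := by
    intro i hi j hj hij
    rw [Finset.mem_coe, Finset.mem_range] at hi hj
    have h1 := (hf i (by omega)).2
    have h2 := (hf j (by omega)).2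
    rw [hij] at h1
    omega
  have := Finset.card_le_card_of_injOn f
    (fun i hi => (hf i (by rw [Finset.mem_coe, Finset.mem_range] at hi; omega)).1) hinj
  rw [Finset.card_range] at this
  omega

theorem exists_finset_cov (C : State n) :
    ∃ S : Finset Node, S.card ≤ 2 * n ∧ ∀ v, Cov C v → v ∈ S := by
  classical
  refine ⟨Finset.univ.image C.pos ∪
    -- The default 0 makes a contracted particle contribute its own node again.
    Finset.univ.image (fun p => C.pos p + (C.dir p).elim 0 Dir.vec), ?_, ?_⟩
  · refine (Finset.card_union_le _ _).trans ?_
    have h1 := Finset.card_image_le (s := Finset.univ) (f := C.pos)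
    have h2 := Finset.card_image_le (s := Finset.univ)
      (f := fun p => C.pos p + (C.dir p).elim 0 Dir.vec)
    rw [Finset.card_univ, Fintype.card_fin] at h1 h2
    omega
  · rintro v (⟨p, hp⟩ | ⟨p, d, hd, hp⟩)
    · exact Finset.mem_union_left _ (Finset.mem_image.2 ⟨p, Finset.mem_univ _, hp⟩)
    · refine Finset.mem_union_right _ (Finset.mem_image.2 ⟨p, Finset.mem_univ _, ?_⟩)
      rw [hd]; exact hp

theorem Link.abs_le {C : State n} {a b : Node} (h : Link C a b) : |b.1 - a.1| ≤ 2 := by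
  rcases h with ⟨rfl, -⟩ | ⟨-, rfl | rfl | ⟨rfl, -⟩⟩ <;> simp

theorem CovConnected.fst_sub_le {C : State n} (h : CovConnected C) {a b : Node} (ha : Cov C a)
    (hb : Cov C b) : b.1 - a.1 ≤ 4 * n + 1 := by
  obtain ⟨S, hcard, hS⟩ := exists_finset_cov C
  have := fst_sub_le_of_eqvGen (S := S)
    (fun a b hab => ⟨hS a hab.1, hS b hab.2.1, hab.2.2.abs_le⟩) (h a b ha hb)
  omega

/-! ### The potential -/

/-- Every expansion and every movement of WRain increases this quantity by one. -/
def potential (C : State n) : ℤ := ∑ p, (2 * (C.pos p).1 + if C.dir p = none then 0 else 1)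

theorem sum_eq_add_one {f g : Fin n → ℤ} (p : Fin n) (hp : g p = f p + 1)
    (hq : ∀ q, q ≠ p → g q = f q) : ∑ q, g q = ∑ q, f q + 1 := by
  rw [← Finset.add_sum_erase _ _ (Finset.mem_univ p),
    ← Finset.add_sum_erase Finset.univ f (Finset.mem_univ p), hp,
    Finset.sum_congr rfl fun q hq' => hq q (Finset.ne_of_mem_erase hq')]
  ring

/-- An expansion adds the 1 of the indicator; a contraction to E or SE adds 2 and removes that 1. -/
theorem Inv.potential_step {C : State n} {y : ℤ} {v₀ : Node} (h : Inv y v₀ C) (p : Fin n) :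
    ((Silbot.step WRain C p).pos = C.pos ∧ (Silbot.step WRain C p).dir = C.dir ∧
      potential (Silbot.step WRain C p) = potential C) ∨
    potential (Silbot.step WRain C p) = potential C + 1 := by
  rcases step_cases WRain C p with ⟨-, hs⟩ | ⟨-, hs⟩ | ⟨d, hp, -, hs⟩ | ⟨d, -, hd, he, hs⟩ <;>
    rw [hs]
  · left; exact ⟨rfl, rfl, rfl⟩
  · left; exact ⟨rfl, rfl, rfl⟩
  · right
    refine sum_eq_add_one p ?_ fun q hq => ?_
    · simp [(h.expand_eq p d hp).1]
    · simp [hq]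
  · right
    refine sum_eq_add_one p ?_ fun q hq => ?_
    · rcases h.dir_eq p d hd with rfl | rfl <;> simp [hd, Dir.vec] <;> ring
    · simp [hq]

/-- In both states a particle is within 4n + 1 columns of the common anchor `v₀`, so its summand
grows by at most 2(8n + 2) + 1. -/
theorem Inv.potential_sub_le {C C' : State n} {y : ℤ} {v₀ : Node} (h : Inv y v₀ C)
    (h' : Inv y v₀ C') : potential C' - potential C ≤ n * (16 * n + 5) := by
  unfold potential
  rw [← Finset.sum_sub_distrib]
  refine (Finset.sum_le_card_nsmul _ _ (16 * (n : ℤ) + 5) fun p _ => ?_).trans ?_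
  · have h1 := h'.conn.fst_sub_le h'.cov_base (Or.inl ⟨p, rfl⟩ : Cov C' (C'.pos p))
    have h2 := h.conn.fst_sub_le (Or.inl ⟨p, rfl⟩ : Cov C (C.pos p)) h.cov_base
    split_ifs <;> omega
  · rw [Finset.card_univ, Fintype.card_fin, nsmul_eq_mul]

theorem Inv.moves_le_potential {C : State n} {y : ℤ} {v₀ : Node} (h : Inv y v₀ C)
    (σ : ℕ → Fin n) (t : ℕ) :
    (moves WRain C σ t : ℤ) ≤ potential (Silbot.run WRain C σ t) - potential C := by
  induction t with
  | zero => rw [Silbot.run, sub_self]; simp [moves]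
  | succ t ih =>
    rw [moves_succ]
    change ((moves WRain C σ t + if (Silbot.step WRain (Silbot.run WRain C σ t) (σ t)).pos ≠
      (Silbot.run WRain C σ t).pos then 1 else 0 : ℕ) : ℤ) ≤
      potential (Silbot.step WRain (Silbot.run WRain C σ t) (σ t)) - _
    rcases (h.run σ t).potential_step (σ t) with ⟨h1, -, h2⟩ | h2
    · rw [if_neg (not_not.2 h1), h2]; simpa using ih
    · rw [h2]
      split_ifs <;> push_cast <;> linarith

theorem IsInitial.exists_inv {C : State n} (hC : IsInitial C) : ∃ y v₀, Inv y v₀ C := by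
  obtain ⟨⟨_, p, -⟩⟩ := hC.2.2.1.nonempty
  obtain ⟨p₀, -, hp₀⟩ := Finset.exists_min_image Finset.univ (fun q => (C.pos q).2)
    ⟨p, Finset.mem_univ p⟩
  exact ⟨_, _, hC.inv p₀ fun q => hp₀ q (Finset.mem_univ q)⟩

theorem totalMoves_le {C : State n} (hC : IsInitial C) (σ : ℕ → Fin n) :
    totalMoves WRain C σ ≤ ((21 * n ^ 2 : ℕ) : ℕ∞) := by
  obtain ⟨y, v₀, h⟩ := hC.exists_inv
  refine iSup_le fun t => ?_
  have h1 := h.moves_le_potential σ t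
  have h2 := h.potential_sub_le (h.run σ t)
  have hn : (1 : ℤ) ≤ n := by exact_mod_cast (σ 0).pos
  have h3 : (moves WRain C σ t : ℤ) ≤ 21 * (n : ℤ) ^ 2 := by nlinarith
  exact_mod_cast h3

/-! ### Termination -/

/-- The potential is a bounded, nondecreasing integer; once it is maximal, any further change would
increase it. -/
theorem Inv.exists_stable {C : State n} {y : ℤ} {v₀ : Node} (h : Inv y v₀ C) (σ : ℕ → Fin n) :
    ∃ T, ∀ t, T ≤ t → (Silbot.run WRain C σ t).pos = (Silbot.run WRain C σ T).pos ∧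
      (Silbot.run WRain C σ t).dir = (Silbot.run WRain C σ T).dir := by
  have hmono : Monotone fun t => potential (Silbot.run WRain C σ t) := by
    refine monotone_nat_of_le_succ fun t => ?_
    change _ ≤ potential (Silbot.step WRain (Silbot.run WRain C σ t) (σ t))
    rcases (h.run σ t).potential_step (σ t) with ⟨-, -, h2⟩ | h2 <;> omega
  obtain ⟨m, ⟨T, hT⟩, hm⟩ := Int.exists_greatest_of_bdd
    (P := fun m => ∃ t, potential (Silbot.run WRain C σ t) = m)
    ⟨potential C + n * (16 * n + 5), by
      rintro _ ⟨t, rfl⟩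
      linarith [h.potential_sub_le (h.run σ t)]⟩ ⟨_, 0, rfl⟩
  refine ⟨T, fun t ht => ?_⟩
  induction t, ht using Nat.le_induction with
  | base => exact ⟨rfl, rfl⟩
  | succ t ht ih =>
    have h1 := hm _ ⟨t + 1, rfl⟩
    have h2 := hmono ht
    rw [← ih.1, ← ih.2]
    change potential (Silbot.step WRain (Silbot.run WRain C σ t) (σ t)) ≤ m at h1
    change (Silbot.step WRain (Silbot.run WRain C σ t) (σ t)).pos = _ ∧
      (Silbot.step WRain (Silbot.run WRain C σ t) (σ t)).dir = _
    rcases (h.run σ t).potential_step (σ t) with ⟨h3, h4, -⟩ | h3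
    · exact ⟨h3, h4⟩
    · simp only [hT] at h2
      omega

theorem step_todo_of_ne (A : Algorithm) (C : State n) {p q : Fin n} (h : q ≠ p) :
    (step A C p).todo q = C.todo q := by
  rcases step_cases A C p with ⟨-, hs⟩ | ⟨-, hs⟩ | ⟨d, -, -, hs⟩ | ⟨d, -, -, -, hs⟩ <;>
    rw [hs] <;> simp [h]

theorem step_todo_self {A : Algorithm} {C : State n} {p : Fin n} {a : Decision}
    (h : C.todo p = some a) : (step A C p).todo p = none := by
  rcases step_cases A C p with ⟨h', -⟩ | ⟨-, hs⟩ | ⟨d, -, -, hs⟩ | ⟨d, -, -, -, hs⟩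
  · rw [h] at h'; cases h'
  all_goals rw [hs]; simp

theorem step_todo_none {A : Algorithm} {C : State n} {p : Fin n} (h : C.todo p = none) :
    (step A C p).todo p = some (look A C p) := by
  simp [step, h]

/-- The next event at `p`. -/
theorem Fair.exists_next {σ : ℕ → Fin n} (hσ : Fair σ) (A : Algorithm) (C : State n) (p : Fin n)
    (t : ℕ) : ∃ s, t ≤ s ∧ σ s = p ∧ (run A C σ s).todo p = (run A C σ t).todo p := by
  classical
  have hex := hσ p t
  obtain ⟨hs, hsp⟩ := Nat.find_spec hex
  refine ⟨Nat.find hex, hs, hsp, ?_⟩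
  have key : ∀ u, t ≤ u → u ≤ Nat.find hex → (run A C σ u).todo p = (run A C σ t).todo p := by
    intro u hu
    induction u, hu using Nat.le_induction with
    | base => exact fun _ => rfl
    | succ u hu ih =>
      intro hle
      rw [← ih (by omega)]
      refine step_todo_of_ne A _ ?_
      rintro rfl
      exact Nat.find_min hex (by omega : u < Nat.find hex) ⟨hu, rfl⟩
  exact key _ hs le_rfl

/-- There is nothing to do for `p`. -/
def Idle (C : State n) (p : Fin n) : Prop :=
  (∃ d, C.dir p = some d ∧ Occ C (C.pos p + d.vec)) ∨
    (C.dir p = none ∧ (NearAt C (C.pos p) ∨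
      ¬ Ptd C (C.pos p) ∧ (UpperAt C (C.pos p) ∨ ¬ LowerAt C (C.pos p))))

theorem idle_of_eq {C C' : State n} (hp : C'.pos = C.pos) (hd : C'.dir = C.dir) :
    Idle C' = Idle C := by
  funext p
  simp only [Idle, NearAt, UpperAt, LowerAt, occ_of_pos_eq hp, ptd_of_eq hp hd, hp, hd]

/-- An edge is blocked only by a particle expanded to W or NW, which never occurs, so a pending
expansion always succeeds. -/
theorem Inv.step_expand {C : State n} {y : ℤ} {v₀ : Node} (h : Inv y v₀ C) {p : Fin n} {d : Dir}
    (hp : C.todo p = some (.expand d)) : (Silbot.step WRain C p).dir ≠ C.dir := by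
  obtain ⟨hdir, hd⟩ := h.expand_eq p d hp
  have hb : ¬ EdgeBlocked C (C.pos p) d := by
    rintro ⟨q, -, hq⟩
    have := h.dir_eq q _ hq
    rcases hd with rfl | rfl <;> simp [Dir.opp] at this
  have hs : (Silbot.step WRain C p).dir p = some d := by
    simp [Silbot.step, hp, act, hb]
  intro h'
  rw [h', hdir] at hs
  cases hs

theorem step_contract {A : Algorithm} {C : State n} {p : Fin n} {d : Dir}
    (hp : C.todo p = some .contract) (hd : C.dir p = some d)
    (he : EmptyNode C (C.pos p + d.vec)) : (step A C p).pos ≠ C.pos := by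
  have hs : (step A C p).pos p = C.pos p + d.vec := by
    simp [step, hp, act, hd, he]
  intro h'
  rw [h'] at hs
  exact d.vec_ne_zero (by simpa using hs)

section Stable

variable {C : State n} {y : ℤ} {v₀ : Node} {σ : ℕ → Fin n} {T : ℕ}

theorem Inv.not_expand_of_stable (h : Inv y v₀ C) (hσ : Fair σ)
    (hT : ∀ t, T ≤ t → (Silbot.run WRain C σ t).pos = (Silbot.run WRain C σ T).pos ∧
      (Silbot.run WRain C σ t).dir = (Silbot.run WRain C σ T).dir)
    {t : ℕ} (ht : T ≤ t) (p : Fin n) (d : Dir) :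
    (Silbot.run WRain C σ t).todo p ≠ some (.expand d) := by
  intro hp
  obtain ⟨s, hs, hsp, hst⟩ := hσ.exists_next WRain C p t
  rw [hp] at hst
  refine (h.run σ s).step_expand hst ?_
  have h1 := (hT (s + 1) (by omega)).2
  rw [← (hT s (by omega)).2] at h1
  rw [← hsp]
  exact h1

theorem Inv.idle_of_stable (h : Inv y v₀ C) (hσ : Fair σ)
    (hT : ∀ t, T ≤ t → (Silbot.run WRain C σ t).pos = (Silbot.run WRain C σ T).pos ∧
      (Silbot.run WRain C σ t).dir = (Silbot.run WRain C σ T).dir) (p : Fin n) :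
    Idle (Silbot.run WRain C σ T) p := by
  -- A decision pending at time `T` may be outdated, so `p` is observed at an event where it senses
  -- afresh. Any decision other than to stay would later be executed and change the stable
  -- configuration.
  obtain ⟨s, hs, hsp, hnone⟩ : ∃ s, T ≤ s ∧ σ s = p ∧ (Silbot.run WRain C σ s).todo p = none := by
    obtain ⟨s, hs, hsp, -⟩ := hσ.exists_next WRain C p T
    rcases hp : (Silbot.run WRain C σ s).todo p with _ | a
    · exact ⟨s, hs, hsp, hp⟩
    · obtain ⟨s', hs', hsp', hst⟩ := hσ.exists_next WRain C p (s + 1)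
      refine ⟨s', by omega, hsp', hst.trans ?_⟩
      subst hsp
      exact step_todo_self hp
  have hlook : (Silbot.run WRain C σ (s + 1)).todo p =
      some (Silbot.look WRain (Silbot.run WRain C σ s) p) := by
    subst hsp
    exact step_todo_none hnone
  rw [← idle_of_eq (hT s hs).1 (hT s hs).2]
  rcases look_cases (h.run σ s).inj p with ⟨-, h2⟩ | ⟨h1, d, hd, ho⟩ | ⟨-, h1, -⟩ | ⟨-, h1, -⟩
  · exact h2
  · exfalso
    rw [h1] at hlook
    obtain ⟨u, hu, hup, hut⟩ := hσ.exists_next WRain C p (s + 1)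
    rw [hlook] at hut
    have hp : (Silbot.run WRain C σ u).pos = (Silbot.run WRain C σ s).pos := by
      rw [(hT u (by omega)).1, (hT s hs).1]
    have hd' : (Silbot.run WRain C σ u).dir = (Silbot.run WRain C σ s).dir := by
      rw [(hT u (by omega)).2, (hT s hs).2]
    refine step_contract (A := WRain) hut (by rw [hd', hd])
      (emptyNode_iff.2 (by rwa [occ_of_pos_eq hp, hp])) ?_
    have h1 := (hT (u + 1) (by omega)).1
    rw [← (hT u (by omega)).1] at h1
    rw [← hup]
    exact h1
  · rw [h1] at hlook
    exact absurd hlook (h.not_expand_of_stable hσ hT (by omega) p _)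
  · rw [h1] at hlook
    exact absurd hlook (h.not_expand_of_stable hσ hT (by omega) p _)

end Stable

/-! ### Idle configurations are lines on the floor -/

theorem neg_mem_lowerOffsets {o : Node} (ho : o ∈ upperOffsets) : -o ∈ lowerOffsets ∧ 0 < o.2 := by
  simp only [upperOffsets, List.mem_cons, List.not_mem_nil, or_false] at ho
  rcases ho with rfl | rfl | rfl | rfl | rfl <;> simp [lowerOffsets]

/-- Every pointed node is occupied, so `NearAt` fails everywhere and an idle contracted particle is
not pointed. The target of an easternmost expanded particle would thus hold an expanded particle
further East. -/
theorem allContracted_of_idle {C : State n} (hdirE : ∀ p d, C.dir p = some d → d = .E ∨ d = .SE)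
    (hidle : ∀ p, Idle C p) : AllContracted C := by
  classical
  have hptd : ∀ v, Ptd C v → Occ C v := by
    rintro v ⟨q, d, hq, rfl⟩
    rcases hidle q with ⟨e, he, ho⟩ | ⟨he, -⟩
    · rw [hq] at he; cases he; exact ho
    · rw [hq] at he; cases he
  by_contra hne
  unfold AllContracted at hne
  push Not at hne
  obtain ⟨p, hp⟩ := hne
  obtain ⟨p, hp, hmax⟩ := Finset.exists_max_image (Finset.univ.filter fun p => C.dir p ≠ none)
    (fun p => (C.pos p).1) ⟨p, by simpa using hp⟩
  rw [Finset.mem_filter] at hp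
  obtain ⟨d, hd⟩ := Option.ne_none_iff_exists'.1 hp.2
  have hpt : Ptd C (C.pos p + d.vec) := ⟨p, d, hd, rfl⟩
  obtain ⟨r, hr⟩ := hptd _ hpt
  have hrd : C.dir r ≠ none := by
    intro hrd
    rcases hidle r with ⟨e, he, -⟩ | ⟨-, ⟨e, h1, h2⟩ | ⟨h1, -⟩⟩
    · rw [hrd] at he; cases he
    · exact h1 (hptd _ h2)
    · rw [hr] at h1; exact h1 hpt
  have := hmax r (by simpa using hrd)
  rw [hr] at this
  rcases hdirE p d hd with rfl | rfl <;> simp [Dir.vec] at this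

/-- Among particles satisfying `LowerAt`, a northernmost one can only be idle because of a particle
at an upper offset. By the point symmetry of the two lists of offsets, that one satisfies `LowerAt`
too and lies further North. -/
theorem not_lowerAt_of_idle {C : State n} (hcon : AllContracted C) (hidle : ∀ p, Idle C p)
    (p : Fin n) : ¬ LowerAt C (C.pos p) := by
  classical
  have hptd : ∀ v, ¬ Ptd C v := by
    rintro v ⟨q, d, hq, -⟩
    rw [hcon q] at hq; cases hq
  intro hp
  obtain ⟨p, hp, hmax⟩ := Finset.exists_max_image
    (Finset.univ.filter fun p => LowerAt C (C.pos p)) (fun p => (C.pos p).2) ⟨p, by simpa using hp⟩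
  rw [Finset.mem_filter] at hp
  rcases hidle p with ⟨e, he, -⟩ | ⟨-, ⟨e, -, h2⟩ | ⟨-, ⟨o, ho, r, hr⟩ | h1⟩⟩
  · rw [hcon p] at he; cases he
  · exact hptd _ h2
  · obtain ⟨ho1, ho2⟩ := neg_mem_lowerOffsets ho
    have := hmax r (by
      rw [Finset.mem_filter]
      exact ⟨Finset.mem_univ _, -o, ho1, p, by rw [hr]; abel⟩)
    rw [hr, Prod.snd_add] at this
    omega
  · exact h1 hp.2

theorem Inv.isFinalOn {C : State n} {y : ℤ} {v₀ : Node} (h : Inv y v₀ C)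
    (hidle : ∀ p, Idle C p) : IsFinalOn C y := by
  have hcon := allContracted_of_idle h.dir_eq hidle
  have hlow := not_lowerAt_of_idle hcon hidle
  have hocc : ∀ v, Cov C v → Occ C v := by
    rintro v (hv | ⟨q, d, hq, -⟩)
    · exact hv
    · rw [hcon q] at hq; cases hq
  -- All downward links have offsets in `lowerOffsets`, so only horizontal links remain, and these
  -- are grid edges.
  have hlink : ∀ a b, CovLink C a b → b = a + Dir.E.vec := by
    rintro a b ⟨ha, hb, hab⟩
    obtain ⟨p, rfl⟩ := hocc a ha
    have hb := hocc b hb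
    rcases hab with ⟨hab, -⟩ | ⟨-, hab | hab | ⟨hab, -⟩⟩
    · exact hab
    all_goals
      subst hab
      exact absurd ⟨_, by simp [lowerOffsets], hb⟩ (hlow p)
  have key : ∀ a b, Relation.EqvGen (CovLink C) a b → a.2 = b.2 ∧
      (a ∈ Set.range C.pos ↔ b ∈ Set.range C.pos) ∧
      ∀ ha hb, (triGrid.induce (Set.range C.pos)).Reachable ⟨a, ha⟩ ⟨b, hb⟩ := by
    intro a b hab
    induction hab with
    | rel a b hab =>
      have e := hlink a b hab
      refine ⟨by rw [e]; simp [Dir.vec], iff_of_true (hocc a hab.1) (hocc b hab.2.1), ?_⟩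
      intro ha hb
      exact SimpleGraph.Adj.reachable ⟨Dir.E, e⟩
    | refl a => exact ⟨rfl, Iff.rfl, fun _ _ => SimpleGraph.Reachable.refl _⟩
    | symm a b _ ih => exact ⟨ih.1.symm, ih.2.1.symm, fun ha hb => (ih.2.2 hb ha).symm⟩
    | trans a b c _ _ ih₁ ih₂ =>
      exact ⟨ih₁.1.trans ih₂.1, ih₁.2.1.trans ih₂.2.1, fun ha hc =>
        (ih₁.2.2 ha (ih₁.2.1.1 ha)).trans (ih₂.2.2 _ hc)⟩
  refine ⟨hcon, ?_, fun p => ?_⟩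
  · refine (SimpleGraph.connected_iff _).2 ⟨?_, ⟨⟨v₀, hocc _ h.cov_base⟩⟩⟩
    rintro ⟨a, ha⟩ ⟨b, hb⟩
    exact (key a b (h.conn a b (Or.inl ha) (Or.inl hb))).2.2 ha hb
  · rw [← h.base]
    exact (key _ _ (h.conn _ _ (Or.inl ⟨p, rfl⟩) h.cov_base)).1

theorem exists_isFinalOn {C : State n} {σ : ℕ → Fin n} {y : ℤ} (hC : IsInitial C) (hσ : Fair σ)
    (hy : IsFloor C y) : ∃ T, IsFinalOn (run WRain C σ T) y ∧ ∀ t, T ≤ t →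
      (run WRain C σ t).pos = (run WRain C σ T).pos ∧
      (run WRain C σ t).dir = (run WRain C σ T).dir := by
  obtain ⟨⟨p₀, rfl⟩, hmin⟩ := hy
  have h := hC.inv p₀ hmin
  obtain ⟨T, hT⟩ := h.exists_stable σ
  exact ⟨T, (h.run σ T).isFinalOn (h.idle_of_stable hσ hT), hT⟩

theorem IsFinalOn.isLine {C : State n} {y : ℤ} (h : IsFinalOn C y) : IsLine C :=
  ⟨h.1, h.2.1, (0, y), .E, fun p => ⟨(C.pos p).1, by ext <;> simp [Dir.vec, h.2.2 p]⟩⟩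

theorem solvesLineFormation_wRain : SolvesLineFormation WRain := by
  intro n C σ hC hσ
  obtain ⟨⟨_, p, -⟩⟩ := hC.2.2.1.nonempty
  obtain ⟨p₀, -, hp₀⟩ := Finset.exists_min_image Finset.univ (fun q => (C.pos q).2)
    ⟨p, Finset.mem_univ p⟩
  obtain ⟨T, hT, -⟩ := exists_isFinalOn hC hσ ⟨⟨p₀, rfl⟩, fun q => hp₀ q (Finset.mem_univ q)⟩
  exact ⟨T, hT.isLine⟩

/-! ### Comparison with other algorithms -/

theorem exists_fair (hn : 0 < n) : ∃ σ : ℕ → Fin n, Fair σ := by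
  refine ⟨fun t => ⟨t % n, Nat.mod_lt _ hn⟩, fun p t => ⟨p + n * t, ?_, ?_⟩⟩
  · nlinarith
  · apply Fin.ext
    simp [Nat.mod_eq_of_lt p.2]

theorem worstMoves_wRain_le (n : ℕ) : worstMoves WRain n ≤ ((21 * n ^ 2 : ℕ) : ℕ∞) :=
  iSup_le fun _ => iSup_le fun hC => iSup_le fun σ => iSup_le fun _ => totalMoves_le hC σ

theorem le_worstMoves {B : Algorithm} (hB : SolvesLineFormation B) (hn : 4096 ≤ n) :
    ((n ^ 2 : ℕ) : ℕ∞) ≤ ((64 : ℕ) : ℕ∞) * worstMoves B n := by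
  obtain ⟨C, hC, hcomp⟩ := exists_compact_initial (n := n) (by omega)
  obtain ⟨σ, hσ⟩ := exists_fair (n := n) (by omega)
  obtain ⟨t, ht⟩ := hB n C σ hC hσ
  have h1 := line_moves_ge hC hcomp B σ t ht hn
  have h2 : n ^ 2 ≤ 64 * moves B C σ t := by
    have : (n : ℝ) ^ 2 ≤ 64 * moves B C σ t := by linarith
    exact_mod_cast this
  have h3 : (moves B C σ t : ℕ∞) ≤ worstMoves B n :=
    (le_iSup (fun t => (moves B C σ t : ℕ∞)) t).trans <|
      le_iSup_of_le C <| le_iSup_of_le hC <| le_iSup_of_le σ <| le_iSup_of_le hσ le_rfl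
  calc ((n ^ 2 : ℕ) : ℕ∞) ≤ ((64 * moves B C σ t : ℕ) : ℕ∞) := by exact_mod_cast h2
    _ = ((64 : ℕ) : ℕ∞) * (moves B C σ t : ℕ∞) := by push_cast; rfl
    _ ≤ _ := by gcongr

theorem asymptoticallyOptimal_wRain : AsymptoticallyOptimal WRain := by
  -- The factor combines the upper bound 21n² with the lower bound n²/64.
  refine ⟨solvesLineFormation_wRain, 21 * 64, 4096, fun n hn B hB => ?_⟩
  calc worstMoves WRain n ≤ ((21 * n ^ 2 : ℕ) : ℕ∞) := worstMoves_wRain_le n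
    _ = ((21 : ℕ) : ℕ∞) * ((n ^ 2 : ℕ) : ℕ∞) := by push_cast; rfl
    _ ≤ ((21 : ℕ) : ℕ∞) * (((64 : ℕ) : ℕ∞) * worstMoves B n) := by
        gcongr; exact le_worstMoves hB hn
    _ = ((21 * 64 : ℕ) : ℕ∞) * worstMoves B n := by rw [← mul_assoc, ← Nat.cast_mul]

end Silbot

theorem theorem3 :
    -- every execution of WRain stops in a connected configuration on the initial floor
    (∀ (n : ℕ) (C : Silbot.State n) (σ : ℕ → Fin n) (y : ℤ),
      Silbot.IsInitial C → Silbot.Fair σ → Silbot.IsFloor C y →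
        ∃ T, Silbot.IsFinalOn (Silbot.run Silbot.WRain C σ T) y ∧
          ∀ t, T ≤ t →
            (Silbot.run Silbot.WRain C σ t).pos = (Silbot.run Silbot.WRain C σ T).pos ∧
            (Silbot.run Silbot.WRain C σ t).dir = (Silbot.run Silbot.WRain C σ T).dir) ∧
    -- the upper bound on its movements
    (∃ K : ℕ, ∀ (n : ℕ) (C : Silbot.State n) (σ : ℕ → Fin n),
      Silbot.IsInitial C → Silbot.Fair σ →
        Silbot.totalMoves Silbot.WRain C σ ≤ ((K * n ^ 2 : ℕ) : ℕ∞)) ∧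
    -- the lower bound for every algorithm, from every compact initial configuration
    (∃ c : ℝ, 0 < c ∧ ∃ N : ℕ, ∀ n : ℕ, N ≤ n →
      (∃ C : Silbot.State n, Silbot.IsInitial C ∧ Silbot.Compact C) ∧
      ∀ C : Silbot.State n, Silbot.IsInitial C → Silbot.Compact C →
        ∀ (A : Silbot.Algorithm) (σ : ℕ → Fin n) (t : ℕ),
          Silbot.IsLine (Silbot.run A C σ t) → c * (n : ℝ) ^ 2 ≤ Silbot.moves A C σ t) ∧
    Silbot.AsymptoticallyOptimal Silbot.WRain := by
  refine ⟨fun n C σ y hC hσ hy => Silbot.exists_isFinalOn hC hσ hy,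
    ⟨21, fun n C σ hC _ => Silbot.totalMoves_le hC σ⟩,
    ⟨1 / 64, by norm_num, 4096, fun n hn => ⟨Silbot.exists_compact_initial (by omega), ?_⟩⟩,
    Silbot.asymptoticallyOptimal_wRain⟩
  intro C hC hcomp A σ t hline
  exact Silbot.line_moves_ge hC hcomp A σ t hline hn
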